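/- Proposition (existence of the limiting eigenvalue distribution for $K_{d+1}$). For a finite simple graph $G$ let its barycentric refinement be the finite simple graph whose vertices are the (nonempty) complete subgraphs of $G$, two distinct ones being adjacent if one is contained in the other. Put $G_0=G$ and let $G_{m+1}$ be the barycentric refinement of $G_m$. Let the Laplacian of a finite simple graph be $L=B-A$, where $B$ is the diagonal degree matrix and $A$ the adjacency matrix. If $\lambda_0\le\lambda_1\le\dots\le\lambda_n$ are the eigenvalues of the Laplacian of $G$, counted with multiplicity (so that $n+1$ is the number of vertices), define the spectral function $F_G(x)=\lambda_{\lfloor nx\rfloor}$ for $x\in[0,1]$. Let $d\ge 1$ and $G=K_{d+1}$, the complete graph on $d+1$ vertices. Then the functions $F_{G_m}$ lie in $L^1([0,1])$ and converge in $L^1([0,1])$ as $m\to\infty$: there is a function $F_d\in L^1([0,1])$ with $\lim_{m\to\infty}\int_0^1|F_{G_m}(x)-F_d(x)|\,dx=0$. -/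

import Mathlib

open MeasureTheory Filter Topology

/-- A finite simple graph, bundled with its vertex type. -/
structure FinGraph where
  V : Type
  [fintypeV : Fintype V]
  graph : SimpleGraph V

attribute [instance] FinGraph.fintypeV

namespace FinGraph

/-- The complete graph `K_n` on `n` vertices. -/
def complete (n : ℕ) : FinGraph where
  V := Fin n
  graph := ⊤

open Classical in
/-- The barycentric refinement of `G`: its vertices are the (nonempty) complete subgraphs of `G`,
given by their vertex sets, and two distinct ones are adjacent when one is contained in the
other. -/
noncomputable def refine (G : FinGraph) : FinGraph where
  V := {s : Finset G.V // s.Nonempty ∧ G.graph.IsClique (s : Set G.V)}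
  graph :=
    { Adj := fun s t => s ≠ t ∧ (s.1 ⊆ t.1 ∨ t.1 ⊆ s.1)
      symm := ⟨fun _ _ h => ⟨h.1.symm, h.2.symm⟩⟩
      loopless := ⟨fun _ h => h.1 rfl⟩ }

/-- The `m`-th barycentric refinement `G_m` of `G = G_0`. -/
noncomputable def iterRefine (G : FinGraph) (m : ℕ) : FinGraph :=
  refine^[m] G

open Classical in
/-- The `k`-th eigenvalue `λ_k`, for `0 ≤ k < |V|`, of the Laplacian (degree matrix minus adjacency
matrix) of `G`, in increasing order `λ_0 ≤ λ_1 ≤ ⋯` and with multiplicity. Mathlib's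
`eigenvalues₀` is in decreasing order, hence `Fin.rev`. The value for `k ≥ |V|` is a placeholder. -/
noncomputable def lapEigenvalue (G : FinGraph) (k : ℕ) : ℝ :=
  if h : k < Fintype.card G.V then
    (G.graph.isHermitian_lapMatrix ℝ).eigenvalues₀ (Fin.rev ⟨k, h⟩)
  else 0

/-- The spectral function `F_G(x) = λ_{⌊n x⌋}` for `x ∈ [0, 1]`, where `λ_0 ≤ ⋯ ≤ λ_n` are the
Laplacian eigenvalues of `G`, that is, `n = |V| - 1`. Only its values on `[0, 1]` matter; there
the index is at most `n`. -/
noncomputable def spectralFunction (G : FinGraph) (x : ℝ) : ℝ :=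
  G.lapEigenvalue ⌊((Fintype.card G.V - 1 : ℕ) : ℝ) * x⌋₊

end FinGraph

/-! Write D = d + 1. The first subdivision of the simplex K_D consists of D! simplices glued along
faces, and G_{m+1} is its m-th refinement. Call a vertex of an m-th refinement interior if its
carrier has D vertices, and delete every edge that does not join two interior vertices. For the
subdivided simplex this leaves D! disjoint copies of what it leaves for the simplex itself, up to
isolated vertices (`IsChamberCover.lapCount_interior`). Draw the decreasing eigenvalues, padded by
zeros, as a step function on the half line with (D!)^m steps per unit. After the deletion, G_m and
G_{m+1} then give the same function: isolated vertices only add zeros at the end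
(`lapEig_interior_refine`).

Deleting edges lowers every eigenvalue, by Weyl monotonicity, so the L¹ cost is a difference of
traces: the number of deleted oriented edges divided by (D!)^m (`sum_abs_lapEig_sub`). A chamber
count bounds that number by a constant times (d · d!)^m (`boundaryCount_succ_le`,
`removed_succ_le`). The cost is thus O((d/(d+1))^m), and the step functions are Cauchy in L¹.

On [0,1] the spectral function is such a step function composed with a decreasing affine map
(`spectralFunction_ae_eq`). The coefficients converge because |V(G_m)|/(D!)^m decreases to a
positive limit c, and composition with affine maps is continuous in L¹
(`tendsto_eLpNorm_comp_affine_sub`). -/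

namespace Matrix.IsHermitian

/-! ### Counting eigenvalues of Hermitian matrices -/

variable {n : Type*} [Fintype n] [DecidableEq n] {A B : Matrix n n ℝ}

lemma inner_toEuclideanLin_self (hA : A.IsHermitian) (x : EuclideanSpace ℝ n) :
    inner ℝ x (A.toEuclideanLin x) =
      ∑ i, hA.eigenvalues i * (inner ℝ (hA.eigenvectorBasis i) x) ^ 2 := by
  have hs := isSymmetric_toEuclideanLin_iff.mpr hA
  rw [← hA.eigenvectorBasis.sum_inner_mul_inner x (A.toEuclideanLin x)]
  refine Finset.sum_congr rfl fun i _ => ?_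
  have hi : A.toEuclideanLin (hA.eigenvectorBasis i) =
      hA.eigenvalues i • hA.eigenvectorBasis i := by
    ext j
    simpa using congrFun (hA.mulVec_eigenvectorBasis i) j
  rw [← hs, hi, real_inner_smul_left, real_inner_comm]
  ring

/-- Weyl monotonicity, in terms of the number of eigenvalues above a threshold. -/
lemma card_lt_eigenvalues_mono (hA : A.IsHermitian) (hB : B.IsHermitian)
    (h : (B - A).PosSemidef) (t : ℝ) :
    Fintype.card {i // t < hA.eigenvalues i} ≤ Fintype.card {i // t < hB.eigenvalues i} := by
  by_contra! hlt
  -- A nonzero kernel vector x is orthogonal to the eigenvectors of A with eigenvalue at most t and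
  -- to those of B with eigenvalue above t. Hence ⟨x, Bx⟩ ≤ t|x|² < ⟨x, Ax⟩, against A ≤ B. Under
  -- `hlt` the target has dimension less than n.
  let Φ : EuclideanSpace ℝ n →ₗ[ℝ]
      ({i // ¬ t < hA.eigenvalues i} → ℝ) × ({i // t < hB.eigenvalues i} → ℝ) :=
    LinearMap.prod
      (LinearMap.pi fun i => (innerSL ℝ (hA.eigenvectorBasis i.1)).toLinearMap)
      (LinearMap.pi fun i => (innerSL ℝ (hB.eigenvectorBasis i.1)).toLinearMap)
  have hker : LinearMap.ker Φ ≠ ⊥ := by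
    apply LinearMap.ker_ne_bot_of_finrank_lt
    have := Fintype.card_subtype_compl (fun i => t < hA.eigenvalues i)
    have := Fintype.card_subtype_le (fun i => t < hA.eigenvalues i)
    simp only [Module.finrank_prod, Module.finrank_fintype_fun_eq_card, finrank_euclideanSpace]
    omega
  obtain ⟨x, hx, hx0⟩ := (Submodule.ne_bot_iff _).1 hker
  have hΦ : Φ x = 0 := hx
  have hxA : ∀ i, ¬ t < hA.eigenvalues i → inner ℝ (hA.eigenvectorBasis i) x = 0 :=
    fun i hi => congrFun (congrArg Prod.fst hΦ) ⟨i, hi⟩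
  have hxB : ∀ i, t < hB.eigenvalues i → inner ℝ (hB.eigenvectorBasis i) x = 0 :=
    fun i hi => congrFun (congrArg Prod.snd hΦ) ⟨i, hi⟩
  have hle : inner ℝ x (A.toEuclideanLin x) ≤ inner ℝ x (B.toEuclideanLin x) := by
    have := h.dotProduct_mulVec_nonneg x.ofLp
    rw [← sub_nonneg, ← inner_sub_right, ← LinearMap.sub_apply, ← map_sub]
    simpa [EuclideanSpace.inner_eq_star_dotProduct, dotProduct_comm, Matrix.sub_mulVec, dotProduct_sub]
      using this
  rw [hA.inner_toEuclideanLin_self, hB.inner_toEuclideanLin_self] at hle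
  have hupper : ∑ i, hB.eigenvalues i * (inner ℝ (hB.eigenvectorBasis i) x) ^ 2 ≤
      ∑ i, t * (inner ℝ (hB.eigenvectorBasis i) x) ^ 2 := by
    refine Finset.sum_le_sum fun i _ => ?_
    by_cases hi : t < hB.eigenvalues i
    · simp [hxB i hi]
    · gcongr
      exact not_lt.1 hi
  have hlower : ∑ i, t * (inner ℝ (hA.eigenvectorBasis i) x) ^ 2 <
      ∑ i, hA.eigenvalues i * (inner ℝ (hA.eigenvectorBasis i) x) ^ 2 := by
    have hex : ∃ i, inner ℝ (hA.eigenvectorBasis i) x ≠ 0 := by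
      by_contra! h0
      apply hx0
      rw [← hA.eigenvectorBasis.repr.map_eq_zero_iff]
      ext i
      simpa [OrthonormalBasis.repr_apply_apply] using h0 i
    obtain ⟨i, hi⟩ := hex
    refine Finset.sum_lt_sum (fun j _ => ?_) ⟨i, Finset.mem_univ i, ?_⟩
    · by_cases hj : t < hA.eigenvalues j
      · gcongr
      · simp [hxA j hj]
    · have : t < hA.eigenvalues i := by
        by_contra hti
        exact hi (hxA i hti)
      exact mul_lt_mul_of_pos_right this (by positivity)
  have hn : ∑ i, t * (inner ℝ (hA.eigenvectorBasis i) x) ^ 2 =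
      ∑ i, t * (inner ℝ (hB.eigenvectorBasis i) x) ^ 2 := by
    rw [← Finset.mul_sum, ← Finset.mul_sum]
    congr 1
    have h1 := hA.eigenvectorBasis.sum_inner_mul_inner x x
    have h2 := hB.eigenvectorBasis.sum_inner_mul_inner x x
    simp only [real_inner_comm x, ← pow_two] at h1 h2 ⊢
    rw [h1, h2]
  linarith

lemma card_lt_eigenvalues_eq_countP (hA : A.IsHermitian) (t : ℝ) :
    Fintype.card {i // t < hA.eigenvalues i} = A.charpoly.roots.countP (t < ·) := by
  rw [hA.roots_charpoly_eq_eigenvalues, Multiset.countP_map, Fintype.card_subtype]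
  rfl

end Matrix.IsHermitian

open Classical in
lemma Matrix.charpoly_blockDiagonal_const {ι U : Type*} [Fintype ι] [Fintype U]
    (M : Matrix U U ℝ) :
    (Matrix.blockDiagonal fun _ : ι => M).charpoly = M.charpoly ^ Fintype.card ι := by
  have : (Matrix.blockDiagonal fun _ : ι => M).charmatrix =
      Matrix.blockDiagonal fun _ : ι => M.charmatrix := by
    ext ⟨i, k⟩ ⟨j, l⟩
    simp only [Matrix.charmatrix_apply, Matrix.blockDiagonal_apply, Matrix.diagonal_apply,
      Prod.mk.injEq]
    split_ifs <;> simp_all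
  rw [Matrix.charpoly, this, Matrix.det_blockDiagonal]
  simp [Matrix.charpoly]

/-! ### Laplacian spectra: monotonicity, trace, disjoint copies -/

namespace SimpleGraph

variable {V : Type*} [Fintype V]

open Classical in
/-- The number of Laplacian eigenvalues above `t`. -/
noncomputable def lapCount (G : SimpleGraph V) (t : ℝ) : ℕ :=
  Fintype.card {i // t < (G.isHermitian_lapMatrix ℝ).eigenvalues i}

open Classical in
/-- The Laplacian eigenvalues in decreasing order, extended by zero. -/
noncomputable def lapEig (G : SimpleGraph V) (j : ℕ) : ℝ :=
  if h : j < Fintype.card V then (G.isHermitian_lapMatrix ℝ).eigenvalues₀ ⟨j, h⟩ else 0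

lemma lapEig_nonneg (G : SimpleGraph V) (j : ℕ) : 0 ≤ G.lapEig j := by
  classical
  unfold lapEig
  split_ifs with h
  · have := (posSemidef_lapMatrix ℝ G).eigenvalues_nonneg
      (Fintype.equivOfCardEq (Fintype.card_fin _) (⟨j, h⟩ : Fin (Fintype.card V)))
    convert this
    simp [Matrix.IsHermitian.eigenvalues]
  · rfl

lemma lapEig_of_card_le (G : SimpleGraph V) {j : ℕ} (h : Fintype.card V ≤ j) :
    G.lapEig j = 0 := by
  simp [lapEig, h.not_gt]

lemma lapEig_antitone (G : SimpleGraph V) : Antitone G.lapEig := by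
  classical
  intro i j hij
  by_cases hj : j < Fintype.card V
  · rw [lapEig, lapEig, dif_pos hj, dif_pos (hij.trans_lt hj)]
    exact Matrix.IsHermitian.eigenvalues₀_antitone _ (by simpa using hij)
  · rw [lapEig_of_card_le G (not_lt.1 hj)]
    exact G.lapEig_nonneg i

/-- Translates between counts and ordered eigenvalues. For negative t it would fail, since the
padding zeros would exceed t without being counted. -/
lemma lt_lapEig_iff (G : SimpleGraph V) {t : ℝ} (ht : 0 ≤ t) (j : ℕ) :
    t < G.lapEig j ↔ j < G.lapCount t := by
  classical
  have hcard : G.lapCount t =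
      ((Finset.range (Fintype.card V)).filter fun j => t < G.lapEig j).card := by
    rw [lapCount, Fintype.card_subtype]
    refine Finset.card_bij
      (fun i _ => ((Fintype.equivOfCardEq (Fintype.card_fin _)).symm i : Fin (Fintype.card V)).1)
      ?_ ?_ ?_
    · intro i hi
      simp only [Finset.mem_filter, Finset.mem_univ, true_and, Finset.mem_range, Fin.is_lt]
        at hi ⊢
      rw [lapEig, dif_pos (Fin.is_lt _)]
      exact hi
    · intro a _ b _ h
      exact (Equiv.injective _) (Fin.ext h)
    · intro j hj
      simp only [Finset.mem_filter, Finset.mem_range] at hj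
      refine ⟨Fintype.equivOfCardEq (Fintype.card_fin _) ⟨j, hj.1⟩,
        Finset.mem_filter.2 ⟨Finset.mem_univ _, ?_⟩, by simp⟩
      have := hj.2
      rw [lapEig, dif_pos hj.1] at this
      simpa only [Matrix.IsHermitian.eigenvalues, Equiv.symm_apply_apply] using this
  constructor
  · intro h
    have hsub : Finset.range (j + 1) ⊆
        (Finset.range (Fintype.card V)).filter fun j => t < G.lapEig j := by
      intro i hi
      have hti : t < G.lapEig i :=
        h.trans_le (G.lapEig_antitone (Nat.lt_succ_iff.1 (Finset.mem_range.1 hi)))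
      refine Finset.mem_filter.2 ⟨Finset.mem_range.2 ?_, hti⟩
      by_contra hi
      rw [lapEig_of_card_le G (not_lt.1 hi)] at hti
      linarith
    have := Finset.card_le_card hsub
    rw [Finset.card_range] at this
    omega
  · intro h
    by_contra hn
    have hsub : ((Finset.range (Fintype.card V)).filter fun j => t < G.lapEig j) ⊆
        Finset.range j := by
      intro i hi
      rw [Finset.mem_range]
      by_contra hji
      exact hn ((Finset.mem_filter.1 hi).2.trans_le (G.lapEig_antitone (not_lt.1 hji)))
    have := Finset.card_le_card hsub
    rw [Finset.card_range] at this
    omega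

/-- The trace of the Laplacian is the sum of the degrees, and the padding adds nothing. -/
lemma sum_lapEig (G : SimpleGraph V) [DecidableRel G.Adj] {N : ℕ} (hN : Fintype.card V ≤ N) :
    ∑ j ∈ Finset.range N, G.lapEig j = Fintype.card {p : V × V // G.Adj p.1 p.2} := by
  classical
  have h1 : ∑ j ∈ Finset.range N, G.lapEig j = ∑ j ∈ Finset.range (Fintype.card V), G.lapEig j := by
    symm
    apply Finset.sum_subset (Finset.range_mono hN)
    intro j _ hj
    exact lapEig_of_card_le G (by simpa using hj)
  have h2 := (G.isHermitian_lapMatrix ℝ).trace_eq_sum_eigenvalues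
  have h3 : ∑ j ∈ Finset.range (Fintype.card V), G.lapEig j =
      ∑ i, (G.isHermitian_lapMatrix ℝ).eigenvalues i := by
    rw [Finset.sum_range,
      ← Equiv.sum_comp (Fintype.equivOfCardEq (Fintype.card_fin (Fintype.card V)))]
    refine Finset.sum_congr rfl fun i _ => ?_
    rw [lapEig, dif_pos i.2]
    simp only [Matrix.IsHermitian.eigenvalues, Equiv.symm_apply_apply]
    congr!
  rw [h1, h3]
  simp only [RCLike.ofReal_real_eq_id, id] at h2
  rw [← h2]
  simp only [Matrix.trace, Matrix.diag, lapMatrix, degMatrix, Matrix.sub_apply,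
    Matrix.diagonal_apply_eq, adjMatrix_apply, G.irrefl, if_false, sub_zero]
  rw [← Nat.cast_sum, Fintype.card_subtype, Finset.card_filter, Fintype.sum_prod_type]
  congr 1
  refine Finset.sum_congr rfl fun v _ => ?_
  rw [← Finset.card_filter, ← card_neighborFinset_eq_degree, neighborFinset_eq_filter]

/-- The quadratic form of the Laplacian is a sum of (x_i - x_j)² over edges, so additional edges add
a positive semidefinite matrix. -/
lemma lapCount_mono {H G : SimpleGraph V} (h : H ≤ G) (t : ℝ) : H.lapCount t ≤ G.lapCount t := by
  classical
  refine Matrix.IsHermitian.card_lt_eigenvalues_mono _ _ ?_ t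
  refine Matrix.PosSemidef.of_dotProduct_mulVec_nonneg
    ((G.isHermitian_lapMatrix ℝ).sub (H.isHermitian_lapMatrix ℝ)) fun x => ?_
  have hG := lapMatrix_toLinearMap₂' ℝ G x
  have hH := lapMatrix_toLinearMap₂' ℝ H x
  rw [Matrix.toLinearMap₂'_apply'] at hG hH
  rw [Matrix.sub_mulVec, dotProduct_sub, star_trivial, hG, hH, sub_nonneg]
  gcongr with i _ j _
  split_ifs with h1 h2 h2
  · rfl
  · exact absurd (h h1) h2
  · positivity
  · rfl

lemma lapEig_mono {H G : SimpleGraph V} (h : H ≤ G) (j : ℕ) : H.lapEig j ≤ G.lapEig j := by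
  by_contra! hlt
  have h1 := (H.lt_lapEig_iff (G.lapEig_nonneg j) j).1 hlt
  have h2 := (G.lt_lapEig_iff (G.lapEig_nonneg j) j).2 (h1.trans_le (lapCount_mono h _))
  exact lt_irrefl _ h2

/-- Passing to a spanning subgraph decreases the Laplacian eigenvalues by a total of twice the
number of edges removed. -/
lemma sum_abs_lapEig_sub {H G : SimpleGraph V} (h : H ≤ G) [DecidableRel H.Adj]
    [DecidableRel G.Adj] {N : ℕ} (hN : Fintype.card V ≤ N) :
    ∑ j ∈ Finset.range N, |G.lapEig j - H.lapEig j| =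
      Fintype.card {p : V × V // G.Adj p.1 p.2 ∧ ¬ H.Adj p.1 p.2} := by
  classical
  simp_rw [fun j => abs_of_nonneg (sub_nonneg.2 (lapEig_mono h j))]
  rw [Finset.sum_sub_distrib, sum_lapEig G hN, sum_lapEig H hN, sub_eq_iff_eq_add]
  norm_cast
  simp only [Fintype.card_subtype]
  rw [← Finset.card_union_of_disjoint]
  · congr 1
    ext p
    have := @h p.1 p.2
    simp only [Finset.mem_filter, Finset.mem_union, Finset.mem_univ, true_and]
    tauto
  · rw [Finset.disjoint_filter]
    tauto

/-- The eigenvalue count of a disjoint union of copies of `H` and isolated vertices. -/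
lemma lapCount_copies {ι U : Type*} [Fintype ι] [Fintype U] (G : SimpleGraph V)
    (H : SimpleGraph U) (f : U × ι → V) (hf : Function.Injective f)
    (hadj : ∀ u i u' i', G.Adj (f (u, i)) (f (u', i')) ↔ i = i' ∧ H.Adj u u')
    (hiso : ∀ v w, G.Adj v w → v ∈ Set.range f) {t : ℝ} (ht : 0 ≤ t) :
    G.lapCount t = Fintype.card ι * H.lapCount t := by
  classical
  let e : V ≃ (U × ι) ⊕ {v // v ∉ Set.range f} :=
    ((Equiv.ofInjective f hf).sumCongr (Equiv.refl _) |>.trans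
      (Equiv.sumCompl (· ∈ Set.range f))).symm
  have hel : ∀ p, e.symm (Sum.inl p) = f p := fun p => rfl
  have her : ∀ v, e.symm (Sum.inr v) = v.1 := fun v => rfl
  have hiso' : ∀ v w, G.Adj v w → w ∈ Set.range f := fun v w h => hiso w v h.symm
  have hnb : ∀ (u : U) (i : ι), G.degree (f (u, i)) = H.degree u := by
    intro u i
    rw [← card_neighborFinset_eq_degree, ← card_neighborFinset_eq_degree]
    symm
    refine Finset.card_bij (fun u' _ => f (u', i)) ?_ ?_ ?_
    · intro u' hu'
      simpa [hadj] using hu'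
    · intro a _ b _ h
      exact congrArg Prod.fst (hf h)
    · intro v hv
      rw [mem_neighborFinset] at hv
      obtain ⟨⟨u', i'⟩, rfl⟩ := hiso' _ _ hv
      obtain ⟨rfl, h⟩ := (hadj _ _ _ _).1 hv
      exact ⟨u', by simpa using h, rfl⟩
  have hdeg0 : ∀ v, v ∉ Set.range f → G.degree v = 0 := by
    intro v hv
    rw [degree_eq_zero]
    intro w hw
    exact hv (hiso _ _ hw)
  have hmat : (G.lapMatrix ℝ).reindex e e =
      Matrix.fromBlocks (Matrix.blockDiagonal fun _ : ι => H.lapMatrix ℝ) 0 0 0 := by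
    ext p q
    rcases p with ⟨u, i⟩ | v <;> rcases q with ⟨u', i'⟩ | w <;>
      simp only [Matrix.reindex_apply, Matrix.submatrix_apply, hel, her, lapMatrix, degMatrix,
        Matrix.sub_apply, Matrix.diagonal_apply, adjMatrix_apply, Matrix.fromBlocks_apply₁₁,
        Matrix.fromBlocks_apply₁₂, Matrix.fromBlocks_apply₂₁, Matrix.fromBlocks_apply₂₂,
        Matrix.blockDiagonal_apply, hadj, hf.eq_iff, Prod.mk.injEq, Matrix.zero_apply, hnb]
    · split_ifs <;> simp_all
    · rw [if_neg fun h => w.2 ⟨_, h⟩, if_neg fun h => w.2 (hiso' _ _ h), sub_zero]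
    · rw [if_neg fun h => v.2 ⟨_, h.symm⟩, if_neg fun h => v.2 (hiso _ _ h), sub_zero]
    · rw [if_neg fun h => v.2 (hiso _ _ h), hdeg0 _ v.2]
      simp
  have hroots : (G.lapMatrix ℝ).charpoly.roots =
      Fintype.card ι • (H.lapMatrix ℝ).charpoly.roots +
        Fintype.card {v // v ∉ Set.range f} • {0} := by
    rw [← Matrix.charpoly_reindex e, hmat, Matrix.charpoly_fromBlocks_zero₁₂,
      Matrix.charpoly_blockDiagonal_const, Polynomial.roots_mul, Polynomial.roots_pow]
    · congr 1
      rw [Matrix.charpoly_zero, Polynomial.roots_pow, Polynomial.roots_X]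
    · exact mul_ne_zero (pow_ne_zero _ (Matrix.charpoly_monic _).ne_zero)
        (Matrix.charpoly_monic _).ne_zero
  unfold lapCount
  rw [Matrix.IsHermitian.card_lt_eigenvalues_eq_countP,
    Matrix.IsHermitian.card_lt_eigenvalues_eq_countP]
  have hroots' := congrArg (Multiset.countP (t < ·)) hroots
  rw [Multiset.countP_add, Multiset.countP_nsmul, Multiset.countP_nsmul] at hroots'
  -- Isolated vertices contribute only the eigenvalue 0, which is not counted because t ≥ 0.
  have h0 : Multiset.countP (t < ·) ({0} : Multiset ℝ) = 0 := by
    rw [Multiset.countP_eq_zero]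
    simpa using ht
  rw [h0, mul_zero, add_zero] at hroots'
  convert hroots'

/-- Multiplying all counts by k repeats each eigenvalue k times, whence the index j / k. -/
lemma lapEig_of_lapCount {U : Type*} [Fintype U] {G : SimpleGraph V} {H : SimpleGraph U} {k : ℕ}
    (hk : 0 < k) (h : ∀ t, 0 ≤ t → G.lapCount t = k * H.lapCount t) (j : ℕ) :
    G.lapEig j = H.lapEig (j / k) := by
  have key : ∀ t, 0 ≤ t → (t < G.lapEig j ↔ t < H.lapEig (j / k)) := by
    intro t ht
    rw [lt_lapEig_iff _ ht, lt_lapEig_iff _ ht, h t ht, Nat.div_lt_iff_lt_mul hk, mul_comm]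
  apply le_antisymm
  · by_contra! hlt
    exact lt_irrefl _ ((key _ (H.lapEig_nonneg _)).1 hlt)
  · by_contra! hlt
    exact lt_irrefl _ ((key _ (G.lapEig_nonneg _)).2 hlt)

end SimpleGraph

lemma Nat.card_le_card_of_cover {A B X : Type*} [Finite A] (g : A → X) (f : B → X)
    (hf : Function.Injective f) (h : ∀ b, ∃ a, g a = f b) : Nat.card B ≤ Nat.card A := by
  choose k hk using h
  refine Nat.card_le_card_of_injective k fun b b' hb => hf ?_
  rw [← hk, ← hk, hb]

/-! ### Combinatorics of iterated refinements -/

namespace FinGraph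

/-- The `m`-th barycentric refinement, with the last refinement outermost. -/
noncomputable def iter (G : FinGraph) : ℕ → FinGraph
  | 0 => G
  | m + 1 => (G.iter m).refine

lemma iterRefine_eq_iter (G : FinGraph) (m : ℕ) : G.iterRefine m = G.iter m := by
  induction m with
  | zero => rfl
  | succ m ih =>
    rw [iterRefine, Function.iterate_succ_apply', ← iterRefine, ih]
    rfl

/-- Allows G_{m+1} to be viewed as the m-th refinement of the first subdivision, the source of the
self-similarity. -/
lemma iter_refine (G : FinGraph) (m : ℕ) : G.refine.iter m = G.iter (m + 1) := by
  induction m with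
  | zero => rfl
  | succ m ih =>
    rw [iter, ih]
    rfl

/-! ### Cliques of the refinement -/

lemma subset_or_subset_of_isClique {G : FinGraph} {C : Finset G.refine.V}
    (hC : G.refine.graph.IsClique (C : Set G.refine.V)) {s t : G.refine.V} (hs : s ∈ C)
    (ht : t ∈ C) : s.1 ⊆ t.1 ∨ t.1 ⊆ s.1 := by
  by_cases h : s = t
  · left
    rw [h]
  · exact (hC hs ht h).2

lemma exists_top_of_isClique {G : FinGraph} {C : Finset G.refine.V}
    (hC : G.refine.graph.IsClique (C : Set G.refine.V)) (hne : C.Nonempty) :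
    ∃ t ∈ C, ∀ s ∈ C, s.1 ⊆ t.1 := by
  obtain ⟨t, ht, hmax⟩ := C.exists_max_image (fun s => s.1.card) hne
  refine ⟨t, ht, fun s hs => ?_⟩
  rcases subset_or_subset_of_isClique hC hs ht with h | h
  · exact h
  · exact (Finset.eq_of_subset_of_card_le h (hmax s hs)).symm.subset

/-- A clique of the refinement is a chain of nonempty sets, on which cardinality is injective with
values in [1, |T|]. -/
lemma card_le_of_isClique {G : FinGraph} {C : Finset G.refine.V}
    (hC : G.refine.graph.IsClique (C : Set G.refine.V)) {T : Finset G.V}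
    (hT : ∀ s ∈ C, s.1 ⊆ T) : C.card ≤ T.card := by
  have : C.card ≤ (Finset.Icc 1 T.card).card := by
    refine Finset.card_le_card_of_injOn (fun s => s.1.card) ?_ ?_
    · intro s hs
      exact Finset.mem_coe.2 (Finset.mem_Icc.2
        ⟨s.2.1.card_pos, Finset.card_le_card (hT s hs)⟩)
    · intro s hs t ht hst
      rcases subset_or_subset_of_isClique hC hs ht with h | h
      · exact Subtype.ext (Finset.eq_of_subset_of_card_le h hst.symm.le)
      · exact Subtype.ext (Finset.eq_of_subset_of_card_le h hst.le).symm
  simpa using this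

/-! ### Carriers -/

open Classical in
/-- The vertex set of the smallest complete subgraph of `G` whose iterated refinement contains a
given vertex. -/
noncomputable def carrier (G : FinGraph) : (m : ℕ) → (G.iter m).V → Finset G.V
  | 0, v => {v}
  | m + 1, s => Finset.biUnion (Subtype.val s) (G.carrier m)

open Classical in
lemma carrier_succ (G : FinGraph) (m : ℕ) (s : (G.iter m).refine.V) :
    G.carrier (m + 1) s = s.1.biUnion (G.carrier m) := rfl

lemma carrier_mono {G : FinGraph} {m : ℕ} {s t : (G.iter m).refine.V} (h : s.1 ⊆ t.1) :
    G.carrier (m + 1) s ⊆ G.carrier (m + 1) t := by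
  classical
  rw [carrier_succ, carrier_succ]
  exact Finset.biUnion_subset_biUnion_of_subset_left _ h

-- By induction: the largest member t of the chain C has the same carrier as all of C, and its
-- elements form a clique one level down. The cardinality half shows that refinement does not raise
-- the clique bound and that top-dimensional cliques have full carrier.
open Classical in
lemma isClique_biUnion_carrier {G : FinGraph} : ∀ (m : ℕ) (C : Finset (G.iter m).V),
    (G.iter m).graph.IsClique (C : Set (G.iter m).V) →
      G.graph.IsClique (C.biUnion (G.carrier m) : Set G.V) ∧
        C.card ≤ (C.biUnion (G.carrier m)).card
  | 0, C, hC => by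
    have : C.biUnion (G.carrier 0) = C := Finset.biUnion_singleton_eq_self
    rw [this]
    exact ⟨hC, le_rfl⟩
  | m + 1, C, hC => by
    rcases C.eq_empty_or_nonempty with rfl | hne
    · simp
    obtain ⟨t, ht, htop⟩ := exists_top_of_isClique hC hne
    have hU : C.biUnion (G.carrier (m + 1)) = t.1.biUnion (G.carrier m) := by
      rw [← carrier_succ]
      refine (Finset.biUnion_subset.2 fun s hs => carrier_mono (htop s hs)).antisymm ?_
      exact Finset.subset_biUnion_of_mem (G.carrier (m + 1)) ht
    obtain ⟨h1, h2⟩ := isClique_biUnion_carrier m t.1 t.2.2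
    rw [hU]
    exact ⟨h1, (card_le_of_isClique hC htop).trans h2⟩

lemma isClique_carrier {G : FinGraph} {m : ℕ} (v : (G.iter m).V) :
    G.graph.IsClique (G.carrier m v : Set G.V) := by
  classical
  simpa using (isClique_biUnion_carrier m {v} (by simp)).1

open Classical in
lemma isClique_carrier_union {G : FinGraph} {m : ℕ} {v w : (G.iter m).V}
    (h : (G.iter m).graph.Adj v w) :
    G.graph.IsClique ((G.carrier m v ∪ G.carrier m w : Finset G.V) : Set G.V) := by
  have := (isClique_biUnion_carrier m {v, w} (by
    rw [Finset.coe_pair, SimpleGraph.isClique_pair]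
    exact fun _ => h)).1
  rw [Finset.biUnion_insert, Finset.singleton_biUnion] at this
  exact this

/-! ### Functoriality -/

open Classical in
/-- The embedding of refinements induced by an embedding of graphs. -/
noncomputable def refineMap {H G : FinGraph} (f : H.graph ↪g G.graph) :
    H.refine.graph ↪g G.refine.graph where
  toFun s := ⟨s.1.map f.toEmbedding, s.2.1.map, by
    intro a ha b hb hab
    obtain ⟨x, hx, rfl⟩ := Finset.mem_map.1 (Finset.mem_coe.1 ha)
    obtain ⟨y, hy, rfl⟩ := Finset.mem_map.1 (Finset.mem_coe.1 hb)
    exact f.map_rel_iff.2 (s.2.2 hx hy fun h => hab (by rw [h]))⟩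
  inj' s t h := Subtype.ext (Finset.map_injective _ (congrArg Subtype.val h))
  map_rel_iff' {s t} := and_congr
    (not_congr ⟨fun h => Subtype.ext (Finset.map_injective _ (congrArg Subtype.val h)),
      fun h => by rw [h]⟩)
    (or_congr Finset.map_subset_map Finset.map_subset_map)

/-- The embedding of iterated refinements induced by an embedding of graphs. -/
noncomputable def iterMap {H G : FinGraph} (f : H.graph ↪g G.graph) :
    (m : ℕ) → (H.iter m).graph ↪g (G.iter m).graph
  | 0 => f
  | m + 1 => refineMap (iterMap f m)

lemma carrier_iterMap {H G : FinGraph} (f : H.graph ↪g G.graph) : ∀ (m : ℕ) (v : (H.iter m).V),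
    G.carrier m (iterMap f m v) = (H.carrier m v).map f.toEmbedding
  | 0, v => rfl
  | m + 1, s => by
    classical
    have h1 : G.carrier (m + 1) (iterMap f (m + 1) s) =
        ((Subtype.val s).map (iterMap f m).toEmbedding).biUnion (G.carrier m) :=
      carrier_succ G m _
    have h2 : H.carrier (m + 1) s = (Subtype.val s).biUnion (H.carrier m) := carrier_succ H m s
    rw [h1, h2]
    ext x
    simp only [Finset.mem_biUnion, Finset.mem_map]
    constructor
    · rintro ⟨_, ⟨v, hv, rfl⟩, hx⟩
      have hx' : x ∈ (H.carrier m v).map f.toEmbedding := by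
        rw [← carrier_iterMap f m v]
        exact hx
      obtain ⟨y, hy, rfl⟩ := Finset.mem_map.1 hx'
      exact ⟨y, ⟨v, hv, hy⟩, rfl⟩
    · rintro ⟨y, ⟨v, hv, hy⟩, rfl⟩
      refine ⟨_, ⟨v, hv, rfl⟩, ?_⟩
      have : f.toEmbedding y ∈ (H.carrier m v).map f.toEmbedding := Finset.mem_map_of_mem _ hy
      rw [← carrier_iterMap f m v] at this
      exact this

/-- The iterated embedding hits every vertex carried by the image of f: by induction all elements of
s have preimages, and these form a clique since the embedding reflects adjacency. -/
lemma exists_iterMap_eq {H G : FinGraph} (f : H.graph ↪g G.graph) : ∀ (m : ℕ) (v : (G.iter m).V),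
    (∀ x ∈ G.carrier m v, x ∈ Set.range f) → ∃ u, iterMap f m u = v
  | 0, v, h => h v (Finset.mem_singleton_self v)
  | m + 1, s, h => by
    classical
    have hs : ∀ v ∈ Subtype.val s, ∃ u, iterMap f m u = v := by
      intro v hv
      refine exists_iterMap_eq f m v fun x hx => h x ?_
      exact Finset.mem_biUnion.2 ⟨v, hv, hx⟩
    have hmap : (Finset.univ.filter fun u => iterMap f m u ∈ Subtype.val s).map
        (iterMap f m).toEmbedding = Subtype.val s := by
      ext v
      simp only [Finset.mem_map, Finset.mem_filter, Finset.mem_univ, true_and]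
      constructor
      · rintro ⟨u, hu, rfl⟩
        exact hu
      · intro hv
        obtain ⟨u, rfl⟩ := hs v hv
        exact ⟨u, hv, rfl⟩
    refine ⟨⟨Finset.univ.filter fun u => iterMap f m u ∈ Subtype.val s, ?_, ?_⟩, Subtype.ext hmap⟩
    · have := (Subtype.prop s).1
      change (Subtype.val s).Nonempty at this
      rw [← hmap] at this
      exact Finset.map_nonempty.1 this
    · intro a ha b hb hab
      simp only [Finset.coe_filter, Finset.mem_univ, true_and, Set.mem_ofPred_eq] at ha hb
      exact (iterMap f m).map_rel_iff.1
        ((Subtype.prop s).2 ha hb fun h => hab ((iterMap f m).injective h))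

/-! ### Chambers and flags -/

/-- The complete subgraphs on `D` vertices, with an ordering of the vertices. -/
def Chamber (D : ℕ) (G : FinGraph) : Type :=
  {e : Fin D → G.V // ∀ i j, i ≠ j → G.graph.Adj (e i) (e j)}

namespace Chamber

variable {D : ℕ} {G : FinGraph}

instance : Finite (Chamber D G) := inferInstanceAs (Finite {_e : Fin D → G.V // _})

lemma injective (e : Chamber D G) : Function.Injective e.1 := by
  intro i j h
  by_contra hij
  exact (e.2 i j hij).ne h

/-- A chamber as an embedding of the complete graph. -/
def toEmbedding (e : Chamber D G) : (complete D).graph ↪g G.graph where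
  toFun := e.1
  inj' := e.injective
  map_rel_iff' {i j} := ⟨fun h hij => h.ne (congrArg e.1 hij), fun h => e.2 i j h⟩

/-- Reordering the vertices of a chamber. -/
def perm (e : Chamber D G) (p : Equiv.Perm (Fin D)) : Chamber D G :=
  ⟨fun i => e.1 (p i), fun _ _ hij => e.2 _ _ (p.injective.ne hij)⟩

lemma isClique_image [DecidableEq G.V] (e : Chamber D G) (I : Finset (Fin D)) :
    G.graph.IsClique ((I.image e.1 : Finset G.V) : Set G.V) := by
  intro a ha b hb hab
  obtain ⟨i, _, rfl⟩ := Finset.mem_image.1 (Finset.mem_coe.1 ha)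
  obtain ⟨j, _, rfl⟩ := Finset.mem_image.1 (Finset.mem_coe.1 hb)
  exact e.2 i j fun h => hab (by rw [h])

lemma card_image [DecidableEq G.V] (e : Chamber D G) (I : Finset (Fin D)) :
    (I.image e.1).card = I.card := Finset.card_image_of_injective _ e.injective

open Classical in
/-- The chamber of the refinement formed by the initial segments of a chamber. -/
noncomputable def flag (e : Chamber D G) : Chamber D G.refine :=
  ⟨fun i => ⟨(Finset.Iic i).image e.1, Finset.nonempty_Iic.image _, e.isClique_image _⟩, by
    intro i j hij
    refine ⟨fun h => hij ?_, ?_⟩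
    · have := congrArg (fun s => s.1.card) h
      simp only [e.card_image, Fin.card_Iic] at this
      exact Fin.ext (by omega)
    · rcases le_total i j with h | h
      · exact Or.inl (Finset.image_subset_image (Finset.Iic_subset_Iic.2 h))
      · exact Or.inr (Finset.image_subset_image (Finset.Iic_subset_Iic.2 h))⟩

open Classical in
lemma flag_val (e : Chamber D G) (i : Fin D) :
    (e.flag.1 i).1 = (Finset.Iic i).image e.1 := rfl

lemma card_flag (e : Chamber D G) (i : Fin D) : (e.flag.1 i).1.card = i + 1 := by
  classical
  rw [flag_val, card_image, Fin.card_Iic]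

lemma mem_flag (e : Chamber D G) (i : Fin D) (x : G.V) :
    x ∈ (e.flag.1 i).1 ↔ ∃ j ≤ i, e.1 j = x := by
  simp [flag_val]

/-- The position in a flag is determined by the cardinality of the set. -/
lemma eq_of_flag_eq {e e' : Chamber D G} {i j : Fin D} (h : e.flag.1 i = e'.flag.1 j) :
    i = j := by
  have := congrArg (fun s => s.1.card) h
  simp only [card_flag] at this
  exact Fin.ext (by omega)

lemma flag_injective : Function.Injective (flag : Chamber D G → Chamber D G.refine) := by
  intro e e' h
  have hi : ∀ i, e.flag.1 i = e'.flag.1 i := fun i => by rw [h]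
  apply Subtype.ext
  funext i
  have h1 : e.1 i ∈ (e'.flag.1 i).1 := by
    rw [← hi, mem_flag]
    exact ⟨i, le_rfl, rfl⟩
  obtain ⟨j, hj, hji⟩ := (mem_flag _ _ _).1 h1
  rcases hj.eq_or_lt with rfl | hlt
  · exact hji.symm
  · have h2 : e'.1 j ∈ (e.flag.1 j).1 := by
      rw [hi, mem_flag]
      exact ⟨j, le_rfl, rfl⟩
    obtain ⟨k, hk, hkj⟩ := (mem_flag _ _ _).1 h2
    have := e.injective (hkj.trans hji)
    exact absurd (hk.trans_lt hlt) (by rw [this]; exact lt_irrefl _)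

lemma eq_of_range_flag_subset {e e' : Chamber D G}
    (h : ∀ i, ∃ j, e'.flag.1 j = e.flag.1 i) : e = e' := by
  apply flag_injective
  apply Subtype.ext
  funext i
  obtain ⟨j, hj⟩ := h i
  rw [← hj, eq_of_flag_eq hj]

lemma flag_perm_injective : Function.Injective
    (fun p : Chamber D G × Equiv.Perm (Fin D) => p.1.flag.perm p.2) := by
  rintro ⟨e, p⟩ ⟨e', q⟩ h
  have hi : ∀ i, e.flag.1 (p i) = e'.flag.1 (q i) := fun i => congrFun (congrArg Subtype.val h) i
  have hpq : p = q := Equiv.ext fun i => eq_of_flag_eq (hi i)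
  subst hpq
  have : e = e' := eq_of_range_flag_subset fun i => ⟨i, by simpa using (hi (p.symm i)).symm⟩
  rw [this]

/-- Every chain of subsets of a complete subgraph on `D` vertices extends to a full flag. -/
lemma exists_flag {C : Finset G.refine.V} (hC : G.refine.graph.IsClique (C : Set G.refine.V))
    {S : Finset G.V} (hS : G.graph.IsClique (S : Set G.V)) (hcard : S.card = D)
    (hCS : ∀ s ∈ C, s.1 ⊆ S) : ∃ e : Chamber D G, ∀ s ∈ C, ∃ i, e.flag.1 i = s := by
  classical
  let e₀ : Fin D ≃ S := (S.equivFinOfCardEq hcard).symm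
  -- r x counts the chain members missing x. Sorting S by r makes every member of the chain an
  -- initial segment.
  let r : G.V → ℕ := fun x => (C.filter fun s => x ∉ s.1).card
  let σ := Tuple.sort fun i => r (e₀ i)
  have hσ : Monotone fun i => r (e₀ (σ i)) := Tuple.monotone_sort fun i => r (e₀ i)
  let e : Chamber D G := ⟨fun i => e₀ (σ i), fun i j hij => hS (e₀ (σ i)).2 (e₀ (σ j)).2 fun h =>
    hij (σ.injective (e₀.injective (Subtype.ext h)))⟩
  refine ⟨e, fun s hs => ?_⟩
  have hlower : ∀ i j, i ≤ j → e.1 j ∈ s.1 → e.1 i ∈ s.1 := by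
    intro i j hij hj
    by_contra hi
    refine absurd (hσ hij) (not_le.2 (Finset.card_lt_card ?_))
    rw [Finset.ssubset_iff_of_subset]
    · exact ⟨s, Finset.mem_filter.2 ⟨hs, hi⟩, fun h => (Finset.mem_filter.1 h).2 hj⟩
    · intro u hu
      obtain ⟨hu, hju⟩ := Finset.mem_filter.1 hu
      refine Finset.mem_filter.2 ⟨hu, fun hiu => ?_⟩
      rcases subset_or_subset_of_isClique hC hu hs with h | h
      · exact hi (h hiu)
      · exact hju (h hj)
  have hsurj : ∀ x ∈ s.1, ∃ i, e.1 i = x := by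
    intro x hx
    exact ⟨σ.symm (e₀.symm ⟨x, hCS s hs hx⟩), by simp [e]⟩
  let P := Finset.univ.filter fun i => e.1 i ∈ s.1
  have hP : P.Nonempty := by
    obtain ⟨x, hx⟩ := s.2.1
    obtain ⟨i, rfl⟩ := hsurj x hx
    exact ⟨i, Finset.mem_filter.2 ⟨Finset.mem_univ _, hx⟩⟩
  refine ⟨P.max' hP, Subtype.ext ?_⟩
  ext x
  rw [mem_flag]
  have hmax := (Finset.mem_filter.1 (P.max'_mem hP)).2
  constructor
  · rintro ⟨j, hj, rfl⟩
    exact hlower _ _ hj hmax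
  · intro hx
    obtain ⟨i, rfl⟩ := hsurj x hx
    exact ⟨i, P.le_max' i (Finset.mem_filter.2 ⟨Finset.mem_univ _, hx⟩), rfl⟩

end Chamber

/-! ### Purity, clique bounds and chamber counts -/

/-- All complete subgraphs have at most `D` vertices. -/
def CliqueBound (D : ℕ) (G : FinGraph) : Prop :=
  ∀ C : Finset G.V, G.graph.IsClique (C : Set G.V) → C.card ≤ D

/-- Every complete subgraph lies in one with exactly `D` vertices. -/
def IsPure (D : ℕ) (G : FinGraph) : Prop :=
  ∀ C : Finset G.V, G.graph.IsClique (C : Set G.V) → ∃ e : Chamber D G, ∀ v ∈ C, ∃ i, e.1 i = v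

variable {D : ℕ} {G : FinGraph}

lemma CliqueBound.iter (h : CliqueBound D G) (m : ℕ) : CliqueBound D (G.iter m) := by
  classical
  intro C hC
  obtain ⟨h1, h2⟩ := isClique_biUnion_carrier m C hC
  exact h2.trans (h _ h1)

lemma CliqueBound.refine (h : CliqueBound D G) : CliqueBound D G.refine := h.iter 1

lemma IsPure.exists_flag (h : IsPure D G) (C : Finset G.refine.V)
    (hC : G.refine.graph.IsClique (C : Set G.refine.V)) :
    ∃ e : Chamber D G, ∀ s ∈ C, ∃ i, e.flag.1 i = s := by
  classical
  rcases C.eq_empty_or_nonempty with rfl | hne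
  · obtain ⟨e, -⟩ := h ∅ (by simp)
    exact ⟨e, by simp⟩
  obtain ⟨t, ht, htop⟩ := exists_top_of_isClique hC hne
  obtain ⟨e, he⟩ := h t.1 t.2.2
  refine Chamber.exists_flag hC (e.isClique_image Finset.univ) (by simp [e.card_image]) ?_
  intro s hs x hx
  obtain ⟨i, rfl⟩ := he x (htop s hs hx)
  exact Finset.mem_image_of_mem _ (Finset.mem_univ i)

lemma IsPure.refine (h : IsPure D G) : IsPure D G.refine := fun C hC =>
  let ⟨e, he⟩ := h.exists_flag C hC
  ⟨e.flag, he⟩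

lemma IsPure.iter (h : IsPure D G) : ∀ m, IsPure D (G.iter m)
  | 0 => h
  | m + 1 => (h.iter m).refine

lemma cliqueBound_complete (D : ℕ) : CliqueBound D (complete D) := fun C _ =>
  (Finset.card_le_univ C).trans_eq (Fintype.card_fin D)

lemma isPure_complete (D : ℕ) : IsPure D (complete D) := fun _ _ =>
  ⟨⟨fun i => i, fun _ _ h => h⟩, fun v _ => ⟨v, rfl⟩⟩

/-- Every chamber of the refinement is a reordered flag. -/
lemma Chamber.exists_eq_flag_perm (h : CliqueBound D G) (e' : Chamber D G.refine) (hD : 0 < D) :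
    ∃ (e : Chamber D G) (p : Equiv.Perm (Fin D)), e' = e.flag.perm p := by
  classical
  have hC := e'.isClique_image Finset.univ
  obtain ⟨t, ht, htop⟩ := exists_top_of_isClique hC (by
    have : Nonempty (Fin D) := ⟨⟨0, hD⟩⟩
    exact Finset.univ_nonempty.image _)
  have hle := card_le_of_isClique hC htop
  rw [e'.card_image, Finset.card_univ, Fintype.card_fin] at hle
  obtain ⟨e, he⟩ := Chamber.exists_flag hC t.2.2 (le_antisymm (h _ t.2.2) hle) htop
  choose p hp using fun i => he (e'.1 i) (Finset.mem_image_of_mem _ (Finset.mem_univ i))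
  have hinj : Function.Injective p := fun i j hij => e'.injective (by rw [← hp, ← hp, hij])
  refine ⟨e, Equiv.ofBijective p (Finite.injective_iff_bijective.1 hinj), Subtype.ext ?_⟩
  funext i
  exact (hp i).symm

lemma card_chamber_refine (G : FinGraph) (D : ℕ) :
    D.factorial * Nat.card (Chamber D G) ≤ Nat.card (Chamber D G.refine) := by
  have := Nat.card_le_card_of_injective _ (Chamber.flag_perm_injective (D := D) (G := G))
  rw [Nat.card_prod, Nat.card_perm, Nat.card_fin] at this
  rwa [mul_comm]

lemma card_chamber_complete (D : ℕ) : Nat.card (Chamber D (complete D)) = D.factorial := by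
  have : Chamber D (complete D) ≃ (Fin D ↪ Fin D) :=
    { toFun := fun e => ⟨e.1, e.injective⟩
      invFun := fun e => ⟨e, fun _ _ h => e.injective.ne h⟩
      left_inv := fun _ => rfl
      right_inv := fun _ => rfl }
  rw [Nat.card_congr this, Nat.card_eq_fintype_card, Fintype.card_embedding_eq]
  simp [Nat.descFactorial_self]

lemma pow_le_card_chamber (D m : ℕ) :
    D.factorial ^ (m + 1) ≤ Nat.card (Chamber D ((complete D).iter m)) := by
  induction m with
  | zero => simp [iter, card_chamber_complete]
  | succ m ih =>
    rw [pow_succ']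
    exact (Nat.mul_le_mul_left _ ih).trans (card_chamber_refine _ D)

/-- The flag of a chamber is a clique of the refinement, hence a vertex of the second refinement,
and it determines the chamber. This turns chamber counts into lower bounds for vertex counts. -/
lemma card_chamber_le (G : FinGraph) {D : ℕ} (hD : 0 < D) :
    Nat.card (Chamber D G) ≤ Nat.card G.refine.refine.V := by
  classical
  have : Nonempty (Fin D) := ⟨⟨0, hD⟩⟩
  refine Nat.card_le_card_of_injective
    (fun e : Chamber D G => (⟨Finset.univ.image e.flag.1, Finset.univ_nonempty.image _,
      e.flag.isClique_image _⟩ : G.refine.refine.V)) ?_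
  intro e e' h
  have h' : Finset.univ.image e.flag.1 = Finset.univ.image e'.flag.1 := congrArg Subtype.val h
  refine Chamber.eq_of_range_flag_subset fun i => ?_
  have hi := Finset.mem_image_of_mem e.flag.1 (Finset.mem_univ i)
  rw [h'] at hi
  simpa using hi

end FinGraph

/-! ### Cutting refinements into interiors of chambers -/

namespace FinGraph

variable {D : ℕ} {G : FinGraph}

/-- The edges of the iterated refinement between vertices in the interiors of complete subgraphs
on `D` vertices. -/
def interior (D : ℕ) (G : FinGraph) (m : ℕ) : SimpleGraph (G.iter m).V where
  Adj v w := (G.iter m).graph.Adj v w ∧ (G.carrier m v).card = D ∧ (G.carrier m w).card = D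
  symm := ⟨fun _ _ h => ⟨h.1.symm, h.2.2, h.2.1⟩⟩
  loopless := ⟨fun _ h => h.1.ne rfl⟩

lemma interior_le (D : ℕ) (G : FinGraph) (m : ℕ) : interior D G m ≤ (G.iter m).graph :=
  fun _ _ h => h.1

/-- The number of oriented edges that do not belong to the interior. -/
noncomputable def removed (D : ℕ) (G : FinGraph) (m : ℕ) : ℕ :=
  Nat.card {p : (G.iter m).V × (G.iter m).V //
    (G.iter m).graph.Adj p.1 p.2 ∧ ¬ (interior D G m).Adj p.1 p.2}

/-- A family of chambers, without repetition of vertex sets, that contains all complete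
subgraphs. -/
structure IsChamberCover {ι : Type} (ψ : ι → Chamber D G) : Prop where
  inj : ∀ i j, (∀ a, ∃ b, (ψ j).1 b = (ψ i).1 a) → i = j
  cover : ∀ C : Finset G.V, G.graph.IsClique (C : Set G.V) → ∃ i, ∀ v ∈ C, ∃ a, (ψ i).1 a = v

lemma card_carrier_complete_eq_iff {m : ℕ} (v : ((complete D).iter m).V) :
    ((complete D).carrier m v).card = D ↔ (complete D).carrier m v = Finset.univ := by
  rw [← Finset.card_eq_iff_eq_univ]
  have : Fintype.card (complete D).V = D := Fintype.card_fin D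
  rw [this]

lemma card_carrier_complete_le {m : ℕ} (v : ((complete D).iter m).V) :
    ((complete D).carrier m v).card ≤ D := cliqueBound_complete D _ (isClique_carrier v)

lemma card_carrier_iterMap (e : Chamber D G) (m : ℕ) (v : ((complete D).iter m).V) :
    (G.carrier m (iterMap e.toEmbedding m v)).card = ((complete D).carrier m v).card := by
  rw [carrier_iterMap, Finset.card_map]

lemma mem_carrier_iterMap (e : Chamber D G) {m : ℕ} {v : ((complete D).iter m).V}
    (hv : ((complete D).carrier m v).card = D) (x : G.V) :
    x ∈ G.carrier m (iterMap e.toEmbedding m v) ↔ ∃ a, e.1 a = x := by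
  rw [carrier_iterMap, (card_carrier_complete_eq_iff v).1 hv]
  simp only [Finset.mem_map, Finset.mem_univ, true_and]
  rfl

namespace IsChamberCover

variable {ι : Type} {ψ : ι → Chamber D G}

lemma exists_iterMap (h : IsChamberCover ψ) {m : ℕ} (v : (G.iter m).V) :
    ∃ i u, iterMap (ψ i).toEmbedding m u = v := by
  obtain ⟨i, hi⟩ := h.cover _ (isClique_carrier v)
  exact ⟨i, exists_iterMap_eq (ψ i).toEmbedding m v hi⟩

lemma exists_iterMap_pair (h : IsChamberCover ψ) {m : ℕ} {v w : (G.iter m).V}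
    (hvw : (G.iter m).graph.Adj v w) :
    ∃ i u u', iterMap (ψ i).toEmbedding m u = v ∧ iterMap (ψ i).toEmbedding m u' = w := by
  classical
  obtain ⟨i, hi⟩ := h.cover _ (isClique_carrier_union hvw)
  obtain ⟨u, hu⟩ := exists_iterMap_eq (ψ i).toEmbedding m v
    fun x hx => hi x (Finset.mem_union_left _ hx)
  obtain ⟨u', hu'⟩ := exists_iterMap_eq (ψ i).toEmbedding m w
    fun x hx => hi x (Finset.mem_union_right _ hx)
  exact ⟨i, u, u', hu, hu'⟩

lemma card_iter_le [Finite ι] (h : IsChamberCover ψ) (m : ℕ) :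
    Nat.card (G.iter m).V ≤ Nat.card ι * Nat.card ((complete D).iter m).V := by
  rw [← Nat.card_prod]
  refine Nat.card_le_card_of_surjective
    (fun p : ι × ((complete D).iter m).V => iterMap (ψ p.1).toEmbedding m p.2) fun v => ?_
  obtain ⟨i, u, hu⟩ := h.exists_iterMap v
  exact ⟨(i, u), hu⟩

/-- The carriers of adjacent vertices lie in a common chamber, and the embedding of that chamber
preserves carrier sizes, so a deleted edge comes from a deleted edge of the simplex. -/
lemma removed_le [Finite ι] (h : IsChamberCover ψ) (m : ℕ) :
    removed D G m ≤ Nat.card ι * removed D (complete D) m := by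
  rw [removed, removed, ← Nat.card_prod]
  refine Nat.card_le_card_of_cover
    (fun p : ι × {p : ((complete D).iter m).V × ((complete D).iter m).V //
      ((complete D).iter m).graph.Adj p.1 p.2 ∧ ¬ (interior D (complete D) m).Adj p.1 p.2} =>
      (iterMap (ψ p.1).toEmbedding m p.2.1.1, iterMap (ψ p.1).toEmbedding m p.2.1.2))
    Subtype.val Subtype.val_injective ?_
  rintro ⟨⟨v, w⟩, hvw, hint⟩
  obtain ⟨i, u, u', rfl, rfl⟩ := h.exists_iterMap_pair hvw
  refine ⟨(i, ⟨(u, u'), (iterMap (ψ i).toEmbedding m).map_rel_iff.1 hvw, fun hu => hint ?_⟩), rfl⟩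
  exact ⟨hvw, (card_carrier_iterMap _ _ _).trans hu.2.1, (card_carrier_iterMap _ _ _).trans hu.2.2⟩

/-- An interior vertex determines its chamber through its carrier. Carriers of adjacent interior
vertices coincide, because their union is a clique of at most D vertices; so no surviving edge joins
two chambers. Restricting to interior vertices omits only isolated ones. -/
lemma lapCount_interior [Fintype ι] (h : IsChamberCover ψ) (hG : CliqueBound D G) (m : ℕ) {t : ℝ}
    (ht : 0 ≤ t) :
    (interior D G m).lapCount t = Fintype.card ι * ((interior D (complete D) m).comap
      (Subtype.val : {v // ((complete D).carrier m v).card = D} → _)).lapCount t := by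
  classical
  refine SimpleGraph.lapCount_copies (interior D G m) _
    (fun p => iterMap (ψ p.2).toEmbedding m p.1.1) ?_ ?_ ?_ ht
  · rintro ⟨⟨u, hu⟩, i⟩ ⟨⟨u', hu'⟩, j⟩ huu
    have hij : i = j := by
      refine h.inj i j fun a => ?_
      have := (mem_carrier_iterMap (ψ i) hu ((ψ i).1 a)).2 ⟨a, rfl⟩
      dsimp only at huu
      rwa [huu, mem_carrier_iterMap (ψ j) hu'] at this
    subst hij
    have := (iterMap (ψ i).toEmbedding m).injective huu
    subst this
    rfl
  · rintro ⟨u, hu⟩ i ⟨u', hu'⟩ j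
    constructor
    · rintro ⟨hadj, h1, h2⟩
      have hcl := hG _ (isClique_carrier_union hadj)
      have hsub := Finset.eq_of_subset_of_card_le Finset.subset_union_left (hcl.trans_eq h1.symm)
      have hsub' := Finset.eq_of_subset_of_card_le Finset.subset_union_right (hcl.trans_eq h2.symm)
      have hij : i = j := by
        refine h.inj i j fun a => ?_
        have := (mem_carrier_iterMap (ψ i) hu ((ψ i).1 a)).2 ⟨a, rfl⟩
        dsimp only at hsub hsub'
        rwa [hsub.trans hsub'.symm, mem_carrier_iterMap (ψ j) hu'] at this
      subst hij
      exact ⟨rfl, (iterMap (ψ i).toEmbedding m).map_rel_iff.1 hadj, hu, hu'⟩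
    · rintro ⟨rfl, hadj⟩
      exact ⟨(iterMap (ψ i).toEmbedding m).map_rel_iff.2 hadj.1,
        (card_carrier_iterMap _ _ _).trans hu, (card_carrier_iterMap _ _ _).trans hu'⟩
  · intro v w hvw
    obtain ⟨i, u, rfl⟩ := h.exists_iterMap v
    exact ⟨⟨⟨u, (card_carrier_iterMap _ _ _).symm.trans hvw.2.1⟩, i⟩, rfl⟩

end IsChamberCover

/-- With this one-chamber cover, `lapCount_interior` also describes the simplex itself in terms of
the same building block. -/
lemma isChamberCover_complete (D : ℕ) :
    IsChamberCover fun _ : Unit => (⟨fun i => i, fun _ _ h => h⟩ : Chamber D (complete D)) where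
  inj _ _ _ := rfl
  cover _ _ := ⟨(), fun v _ => ⟨v, rfl⟩⟩

lemma isChamberCover_flag (hG : IsPure D G) :
    IsChamberCover (Chamber.flag : Chamber D G → Chamber D G.refine) where
  inj _ _ h := Chamber.eq_of_range_flag_subset h
  cover C hC := hG.exists_flag C hC

lemma lapEig_interior_refine (D m j : ℕ) :
    (interior D (complete D).refine m).lapEig j =
      (interior D (complete D) m).lapEig (j / D.factorial) := by
  classical
  have := Fintype.ofFinite (Chamber D (complete D))
  refine SimpleGraph.lapEig_of_lapCount D.factorial_pos (fun t ht => ?_) j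
  rw [(isChamberCover_flag (isPure_complete D)).lapCount_interior
      (cliqueBound_complete D).refine m ht,
    (isChamberCover_complete D).lapCount_interior (cliqueBound_complete D) m ht,
    ← Nat.card_eq_fintype_card, card_chamber_complete, Fintype.card_unit, one_mul]

lemma removed_refine_le (D m : ℕ) :
    removed D (complete D).refine m ≤ D.factorial * removed D (complete D) m := by
  rw [← card_chamber_complete D]
  exact (isChamberCover_flag (isPure_complete D)).removed_le m

lemma card_iter_succ_le (D m : ℕ) :
    Nat.card ((complete D).iter (m + 1)).V ≤ D.factorial * Nat.card ((complete D).iter m).V := by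
  have := (isChamberCover_flag (isPure_complete D)).card_iter_le m
  rwa [card_chamber_complete, iter_refine] at this

lemma pow_le_card_iter {D : ℕ} (hD : 0 < D) (m : ℕ) :
    D.factorial ^ (m + 1) ≤ Nat.card ((complete D).iter (m + 2)).V :=
  (pow_le_card_chamber D m).trans (card_chamber_le _ hD)

/-! ### Chambers at the boundary -/

lemma IsPure.exists_flag_pair (h : IsPure D G) {v w : G.refine.V} (hvw : G.refine.graph.Adj v w) :
    ∃ (e : Chamber D G) (i j : Fin D), e.flag.1 i = v ∧ e.flag.1 j = w := by
  classical
  obtain ⟨e, he⟩ := h.exists_flag {v, w} (by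
    rw [Finset.coe_pair, SimpleGraph.isClique_pair]
    exact fun _ => hvw)
  obtain ⟨i, hi⟩ := he v (by simp)
  obtain ⟨j, hj⟩ := he w (by simp)
  exact ⟨e, i, j, hi, hj⟩

/-- The number of chambers whose first vertex lies on the boundary. -/
noncomputable def boundaryCount (d m : ℕ) : ℕ :=
  Nat.card {e : Chamber (d + 1) ((complete (d + 1)).iter m) //
    ((complete (d + 1)).carrier m (e.1 0)).card ≠ d + 1}

lemma carrier_subset_carrier_flag {m : ℕ} (e : Chamber D (G.iter m)) {i j : Fin D} (h : i ≤ j) :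
    G.carrier m (e.1 i) ⊆ G.carrier (m + 1) (e.flag.1 j) := by
  classical
  rw [carrier_succ]
  exact Finset.subset_biUnion_of_mem (G.carrier m) ((e.mem_flag j _).2 ⟨i, h, rfl⟩)

/-- The last flag member is a clique of d + 1 vertices, and a clique is no larger than the union of
its carriers. -/
lemma card_carrier_flag_last {d m : ℕ} (e : Chamber (d + 1) ((complete (d + 1)).iter m)) :
    ((complete (d + 1)).carrier (m + 1) (e.flag.1 (Fin.last d))).card = d + 1 := by
  classical
  refine le_antisymm (card_carrier_complete_le (m := m + 1) _) ?_
  rw [carrier_succ]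
  have := (isClique_biUnion_carrier m (e.flag.1 (Fin.last d)).1 (e.flag.1 (Fin.last d)).2.2).2
  rw [e.card_flag] at this
  exact this

lemma card_carrier_ne_of_subset {D m k : ℕ} {v : ((complete D).iter m).V}
    {w : ((complete D).iter k).V} (h : (complete D).carrier m v ⊆ (complete D).carrier k w)
    (hw : ((complete D).carrier k w).card ≠ D) : ((complete D).carrier m v).card ≠ D := by
  have h1 := card_carrier_complete_le w
  have h2 := Finset.card_le_card h
  omega

lemma card_perm_zero_ne_last (d : ℕ) :
    Nat.card {p : Equiv.Perm (Fin (d + 1)) // p 0 ≠ Fin.last d} ≤ d * d.factorial := by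
  have h1 : Nat.card ({i : Fin (d + 1) // i ≠ Fin.last d} × Equiv.Perm (Fin d)) =
      d * d.factorial := by
    rw [Nat.card_prod, Nat.card_perm, Nat.card_fin, Nat.card_eq_fintype_card]
    simp
  have h2 : ∀ p : Equiv.Perm (Fin (d + 1)), (Equiv.Perm.decomposeFin p).1 = p 0 := by
    intro p
    obtain ⟨⟨i, q⟩, rfl⟩ := Equiv.Perm.decomposeFin.symm.surjective p
    rw [Equiv.apply_symm_apply, Equiv.Perm.decomposeFin_symm_apply_zero]
  rw [← h1]
  refine Nat.card_le_card_of_injective (fun p =>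
    (⟨(Equiv.Perm.decomposeFin p.1).1, ?_⟩, (Equiv.Perm.decomposeFin p.1).2)) ?_
  · rw [h2]
    exact p.2
  · intro p q h
    rw [Prod.mk.injEq, Subtype.mk.injEq] at h
    exact Subtype.ext (Equiv.Perm.decomposeFin.injective (Prod.ext h.1 h.2))

/-- Each chamber of the refinement is a flag of some e reordered by some p. If its first vertex is
on the boundary, then p 0 is not the last index, as that flag member is interior, and e starts on
the boundary, as carriers grow along the flag. The first condition leaves d · d! of the (d+1)!
permutations. -/
lemma boundaryCount_succ_le (d m : ℕ) :
    boundaryCount d (m + 1) ≤ d * d.factorial * boundaryCount d m := by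
  refine le_trans ?_ (Nat.mul_le_mul_right _ (card_perm_zero_ne_last d))
  rw [boundaryCount, boundaryCount, ← Nat.card_prod]
  refine Nat.card_le_card_of_cover (X := Chamber (d + 1) ((complete (d + 1)).iter m).refine)
    (fun p : {p : Equiv.Perm (Fin (d + 1)) // p 0 ≠ Fin.last d} ×
      {e : Chamber (d + 1) ((complete (d + 1)).iter m) //
        ((complete (d + 1)).carrier m (e.1 0)).card ≠ d + 1} => p.2.1.flag.perm p.1.1)
    Subtype.val Subtype.val_injective ?_
  rintro ⟨e', he'⟩
  obtain ⟨e, p, rfl⟩ := Chamber.exists_eq_flag_perm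
    ((cliqueBound_complete (d + 1)).iter m) e' d.succ_pos
  refine ⟨⟨⟨p, fun hp => he' ?_⟩, ⟨e, ?_⟩⟩, rfl⟩
  · have := card_carrier_flag_last e
    rw [← hp] at this
    exact this
  · exact card_carrier_ne_of_subset (k := m + 1)
      (carrier_subset_carrier_flag e (Fin.zero_le (p 0))) he'

lemma boundaryCount_le (d m : ℕ) :
    boundaryCount d m ≤ (d * d.factorial) ^ m * (d + 1).factorial := by
  induction m with
  | zero =>
    rw [pow_zero, one_mul, ← card_chamber_complete (d + 1)]
    exact Nat.card_le_card_of_injective Subtype.val Subtype.val_injective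
  | succ m ih =>
    rw [pow_succ', mul_assoc]
    exact (boundaryCount_succ_le d m).trans (Nat.mul_le_mul_left _ ih)

/-- An edge joins positions i and j of the flag of some chamber e. If one endpoint is not interior,
neither is the first vertex of e, whose carrier is contained in those of both endpoints. -/
lemma removed_succ_le (d m : ℕ) :
    removed (d + 1) (complete (d + 1)) (m + 1) ≤ (d + 1) ^ 2 * boundaryCount d m := by
  have h1 : (d + 1) ^ 2 = Nat.card (Fin (d + 1) × Fin (d + 1)) := by
    rw [Nat.card_prod, Nat.card_fin, sq]
  rw [h1, removed, boundaryCount, ← Nat.card_prod]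
  let X := ((complete (d + 1)).iter m).refine.V
  refine Nat.card_le_card_of_cover (X := X × X)
    (fun p : (Fin (d + 1) × Fin (d + 1)) × {e : Chamber (d + 1) ((complete (d + 1)).iter m) //
        ((complete (d + 1)).carrier m (e.1 0)).card ≠ d + 1} =>
      (p.2.1.flag.1 p.1.1, p.2.1.flag.1 p.1.2))
    Subtype.val Subtype.val_injective ?_
  rintro ⟨⟨v, w⟩, hvw, hint⟩
  obtain ⟨e, i, j, hi, hj⟩ := ((isPure_complete (d + 1)).iter m).exists_flag_pair
    (v := v) (w := w) hvw
  refine ⟨⟨(i, j), ⟨e, ?_⟩⟩, Prod.ext hi hj⟩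
  by_cases hv : ((complete (d + 1)).carrier (m + 1) v).card = d + 1
  · have hw : ((complete (d + 1)).carrier (m + 1) w).card ≠ d + 1 := fun hw =>
      hint ⟨hvw, hv, hw⟩
    rw [← hj] at hw
    exact card_carrier_ne_of_subset (k := m + 1)
      (carrier_subset_carrier_flag e (Fin.zero_le j)) hw
  · rw [← hi] at hv
    exact card_carrier_ne_of_subset (k := m + 1)
      (carrier_subset_carrier_flag e (Fin.zero_le i)) hv

end FinGraph

/-! ### L¹ convergence and affine changes of variable -/

open scoped ENNReal

lemma MeasureTheory.eLpNorm_one_sub_le_add {α : Type*} [MeasurableSpace α] {μ : Measure α}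
    {f g k : α → ℝ} (hf : AEStronglyMeasurable f μ) (hg : AEStronglyMeasurable g μ)
    (hk : AEStronglyMeasurable k μ) :
    eLpNorm (f - k) 1 μ ≤ eLpNorm (f - g) 1 μ + eLpNorm (g - k) 1 μ := by
  rw [← sub_add_sub_cancel f g k]
  exact eLpNorm_add_le (hf.sub hg) (hg.sub hk) le_rfl

lemma MeasureTheory.exists_tendsto_eLpNorm_of_le_geometric {f : ℕ → ℝ → ℝ}
    (hf : ∀ n, MemLp (f n) 1 volume) {C r : ℝ≥0∞} (hr : r < 1) (hC : C ≠ ⊤)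
    (h : ∀ n, eLpNorm (f n - f (n + 1)) 1 volume ≤ C * r ^ n) :
    ∃ F, MemLp F 1 volume ∧ Tendsto (fun n => eLpNorm (f n - F) 1 volume) atTop (𝓝 0) := by
  have hcau : CauchySeq fun n => (hf n).toLp (f n) := by
    refine cauchySeq_of_edist_le_geometric r C hr hC fun n => ?_
    rw [Lp.edist_toLp_toLp]
    exact h n
  obtain ⟨F, hF⟩ := cauchySeq_tendsto_of_complete hcau
  refine ⟨F, Lp.memLp F, ?_⟩
  rw [← Lp.tendsto_Lp_iff_tendsto_eLpNorm'' f hf F (Lp.memLp F), Lp.toLp_coeFn]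
  exact hF

lemma lintegral_comp_affine (f : ℝ → ℝ≥0∞) {a : ℝ} (ha : a ≠ 0) (b : ℝ) :
    ∫⁻ x, f (a * x + b) = ENNReal.ofReal |a⁻¹| * ∫⁻ x, f x := by
  rw [← (measurableEmbedding_mulLeft₀ ha).lintegral_map (fun y => f (y + b)),
    Real.map_volume_mul_left ha, lintegral_smul_measure, lintegral_add_right_eq_self f b,
    smul_eq_mul]

lemma eLpNorm_comp_affine (f : ℝ → ℝ) {a : ℝ} (ha : a ≠ 0) (b : ℝ) :
    eLpNorm (fun x => f (a * x + b)) 1 volume = ENNReal.ofReal |a⁻¹| * eLpNorm f 1 volume := by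
  rw [eLpNorm_one_eq_lintegral_enorm, eLpNorm_one_eq_lintegral_enorm]
  exact lintegral_comp_affine (fun y => ‖f y‖ₑ) ha b

lemma MeasureTheory.MemLp.comp_affine {f : ℝ → ℝ} (hf : MemLp f 1 volume) {a : ℝ} (ha : a ≠ 0)
    (b : ℝ) : MemLp (fun x => f (a * x + b)) 1 volume := by
  rw [memLp_one_iff_integrable] at hf ⊢
  exact (hf.comp_add_right b).comp_mul_left' ha

/-- Continuity of the `L¹` norm under affine changes of variable. -/
lemma tendsto_eLpNorm_comp_affine_sub {F : ℝ → ℝ} (hF : MemLp F 1 volume) {α β : ℕ → ℝ} {a b : ℝ}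
    (ha : a ≠ 0) (hα : Tendsto α atTop (𝓝 a)) (hβ : Tendsto β atTop (𝓝 b)) :
    Tendsto (fun m => eLpNorm ((fun x => F (α m * x + β m)) - fun x => F (a * x + b)) 1
      (volume.restrict (Set.Icc (0 : ℝ) 1))) atTop (𝓝 0) := by
  rw [ENNReal.tendsto_nhds_zero]
  intro ε hε
  obtain ⟨δ, hδ0, hδε⟩ := ENNReal.lt_iff_exists_nnreal_btwn.1 hε
  have hδ0 : 0 < δ := by exact_mod_cast hδ0
  set K : ℝ := |a⁻¹| with hK
  have hK0 : 0 < K := abs_pos.2 (inv_ne_zero ha)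
  -- The three errors below are 2Kη, η and Kη, with total δ.
  set η : ℝ := δ / (3 * K + 1) with hη
  have hη0 : 0 < η := div_pos (by exact_mod_cast hδ0) (by positivity)
  obtain ⟨g, hgs, hFg, hgc, hg⟩ := hF.exists_hasCompactSupport_eLpNorm_sub_le ENNReal.one_ne_top
    (ENNReal.ofReal_pos.2 hη0).ne'
  have hgu := hgs.uniformContinuous_of_continuous hgc
  obtain ⟨ρ, hρ0, hρ⟩ := Metric.uniformContinuous_iff.1 hgu η hη0
  have hα0 : ∀ᶠ m in atTop, α m ≠ 0 := hα.eventually_ne ha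
  have hαK : ∀ᶠ m in atTop, |(α m)⁻¹| < 2 * K :=
    ((hα.inv₀ ha).abs).eventually_lt_const (by linarith)
  have hsum : Tendsto (fun m => |α m - a| + |β m - b|) atTop (𝓝 0) := by
    have h1 := (hα.sub_const a).abs
    have h2 := (hβ.sub_const b).abs
    simpa using h1.add h2
  filter_upwards [hα0, hαK, hsum.eventually_lt_const hρ0] with m hm0 hmK hmρ
  have e1 : eLpNorm ((fun x => F (α m * x + β m)) - fun x => g (α m * x + β m)) 1
      (volume.restrict (Set.Icc (0 : ℝ) 1)) ≤ ENNReal.ofReal (2 * K * η) := by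
    refine (eLpNorm_mono_measure _ Measure.restrict_le_self).trans ?_
    refine (eLpNorm_comp_affine (F - g) hm0 (β m)).trans_le ?_
    rw [ENNReal.ofReal_mul (by positivity)]
    gcongr
  have e3 : eLpNorm ((fun x => g (a * x + b)) - fun x => F (a * x + b)) 1
      (volume.restrict (Set.Icc (0 : ℝ) 1)) ≤ ENNReal.ofReal (K * η) := by
    refine (eLpNorm_mono_measure _ Measure.restrict_le_self).trans ?_
    refine (eLpNorm_comp_affine (g - F) ha b).trans_le ?_
    rw [ENNReal.ofReal_mul (by positivity), eLpNorm_sub_comm]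
    gcongr
  have e2 : eLpNorm ((fun x => g (α m * x + β m)) - fun x => g (a * x + b)) 1
      (volume.restrict (Set.Icc (0 : ℝ) 1)) ≤ ENNReal.ofReal η := by
    rw [eLpNorm_one_eq_lintegral_enorm]
    calc _ ≤ ∫⁻ _ in Set.Icc (0 : ℝ) 1, ENNReal.ofReal η := by
          refine setLIntegral_mono measurable_const fun x hx => ?_
          rw [← ofReal_norm]
          refine ENNReal.ofReal_le_ofReal ?_
          have hd : dist (α m * x + β m) (a * x + b) < ρ := by
            refine lt_of_le_of_lt ?_ hmρ
            rw [Real.dist_eq, show α m * x + β m - (a * x + b) = (α m - a) * x + (β m - b) by ring]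
            refine (abs_add_le _ _).trans ?_
            rw [abs_mul, abs_of_nonneg hx.1]
            gcongr
            exact mul_le_of_le_one_right (abs_nonneg _) hx.2
          have := hρ hd
          rw [dist_eq_norm] at this
          exact this.le
      _ = ENNReal.ofReal η := by simp
  have mF := fun (c e : ℝ) (hc : c ≠ 0) =>
    (hF.comp_affine hc e).1.restrict (s := Set.Icc (0 : ℝ) 1)
  have mg := fun (c e : ℝ) (hc : c ≠ 0) =>
    (hg.comp_affine hc e).1.restrict (s := Set.Icc (0 : ℝ) 1)
  have t1 := eLpNorm_one_sub_le_add (mF _ (β m) hm0) (mg _ (β m) hm0) (mF a b ha)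
  have t2 := eLpNorm_one_sub_le_add (mg _ (β m) hm0) (mg a b ha) (mF a b ha)
  refine (t1.trans (add_le_add e1 (t2.trans (add_le_add e2 e3)))).trans (le_trans ?_ hδε.le)
  rw [← ENNReal.ofReal_add (by positivity) (by positivity),
    ← ENNReal.ofReal_add (by positivity) (by positivity), ← ENNReal.ofReal_coe_nnreal]
  refine ENNReal.ofReal_le_ofReal (le_of_eq ?_)
  rw [hη]
  field_simp
  ring

/-! ### Step functions of eigenvalue sequences -/

/-- The step function on the half line with steps of length `1 / M` and values `a`. -/
noncomputable def stepFunction (M : ℝ) (a : ℕ → ℝ) (y : ℝ) : ℝ :=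
  if 0 ≤ y then a ⌊M * y⌋₊ else 0

lemma measurable_stepFunction (M : ℝ) (a : ℕ → ℝ) : Measurable (stepFunction M a) := by
  refine Measurable.ite measurableSet_Ici ?_ measurable_const
  exact (measurable_from_nat (f := a)).comp (Nat.measurable_floor.comp (measurable_const_mul M))

lemma stepFunction_sub (M : ℝ) (a b : ℕ → ℝ) :
    stepFunction M a - stepFunction M b = stepFunction M fun j => a j - b j := by
  ext y
  simp only [stepFunction, Pi.sub_apply]
  split_ifs <;> simp

lemma lintegral_Ici_floor (g : ℕ → ℝ≥0∞) : ∫⁻ y in Set.Ici (0 : ℝ), g ⌊y⌋₊ = ∑' j, g j := by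
  rw [← lintegral_map (f := g) (measurable_from_nat) Nat.measurable_floor, lintegral_countable']
  refine tsum_congr fun j => ?_
  have : (fun y : ℝ => ⌊y⌋₊) ⁻¹' {j} ∩ Set.Ici 0 = Set.Ico (j : ℝ) (j + 1) := by
    ext y
    simp only [Set.mem_inter_iff, Set.mem_preimage, Set.mem_singleton_iff, Set.mem_Ici,
      Set.mem_Ico]
    constructor
    · rintro ⟨h, hy⟩
      exact (Nat.floor_eq_iff hy).1 h
    · intro h
      have hy : 0 ≤ y := (Nat.cast_nonneg j).trans h.1
      exact ⟨(Nat.floor_eq_iff hy).2 h, hy⟩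
  rw [Measure.map_apply Nat.measurable_floor (measurableSet_singleton j),
    Measure.restrict_apply (Nat.measurable_floor (measurableSet_singleton j)), this]
  simp

lemma eLpNorm_stepFunction {M : ℝ} (hM : 0 < M) {a : ℕ → ℝ} {N : ℕ} (hN : ∀ j, N ≤ j → a j = 0) :
    eLpNorm (stepFunction M a) 1 volume =
      ENNReal.ofReal ((∑ j ∈ Finset.range N, |a j|) / M) := by
  have h1 : stepFunction M a = fun y => stepFunction 1 a (M * y + 0) := by
    ext y
    simp [stepFunction, hM]
  have h2 : eLpNorm (stepFunction 1 a) 1 volume =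
      ENNReal.ofReal (∑ j ∈ Finset.range N, |a j|) := by
    rw [eLpNorm_one_eq_lintegral_enorm]
    have : (fun y => ‖stepFunction 1 a y‖ₑ) =
        (Set.Ici (0 : ℝ)).indicator fun y => ‖a ⌊y⌋₊‖ₑ := by
      ext y
      by_cases hy : 0 ≤ y <;> simp [stepFunction, hy]
    rw [this, lintegral_indicator measurableSet_Ici, lintegral_Ici_floor fun j => ‖a j‖ₑ,
      tsum_eq_sum (s := Finset.range N), ENNReal.ofReal_sum_of_nonneg]
    · exact Finset.sum_congr rfl fun j _ => Real.enorm_eq_ofReal_abs _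
    · exact fun j _ => abs_nonneg _
    · intro j hj
      rw [hN j (by simpa using hj), enorm_zero]
  rw [h1, eLpNorm_comp_affine _ hM.ne', h2, ← ENNReal.ofReal_mul (abs_nonneg _), abs_inv,
    abs_of_pos hM, div_eq_inv_mul]

lemma memLp_stepFunction {M : ℝ} (hM : 0 < M) {a : ℕ → ℝ} {N : ℕ} (hN : ∀ j, N ≤ j → a j = 0) :
    MemLp (stepFunction M a) 1 volume := by
  refine ⟨(measurable_stepFunction M a).aestronglyMeasurable, ?_⟩
  rw [eLpNorm_stepFunction hM hN]
  exact ENNReal.ofReal_lt_top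

/-- Repeating every value k times is undone by steps k times finer. -/
lemma stepFunction_mul_div (M : ℝ) (a : ℕ → ℝ) {k : ℕ} (hk : k ≠ 0) :
    stepFunction (k * M) (fun j => a (j / k)) = stepFunction M a := by
  ext y
  have hk' : (k : ℝ) ≠ 0 := Nat.cast_ne_zero.2 hk
  rw [stepFunction, stepFunction, ← Nat.floor_div_natCast, mul_assoc, mul_div_cancel_left₀ _ hk']

/-! ### Convergence of the spectral functions -/

namespace FinGraph

lemma lapEigenvalue_eq_lapEig (G : FinGraph) {k : ℕ} (hk : k < Fintype.card G.V) :
    G.lapEigenvalue k = G.graph.lapEig (Fintype.card G.V - 1 - k) := by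
  have h : Fintype.card G.V - 1 - k < Fintype.card G.V := by omega
  rw [lapEigenvalue, SimpleGraph.lapEig, dif_pos hk, dif_pos h]
  congr 1
  ext
  simp only [Fin.val_rev]
  omega

lemma measurable_spectralFunction (G : FinGraph) : Measurable G.spectralFunction :=
  (measurable_from_nat (f := G.lapEigenvalue)).comp
    (Nat.measurable_floor.comp (measurable_const_mul _))

lemma memLp_spectralFunction (G : FinGraph) :
    MemLp G.spectralFunction 1 (volume.restrict (Set.Icc (0 : ℝ) 1)) := by
  refine MemLp.of_bound G.measurable_spectralFunction.aestronglyMeasurable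
    (∑ k ∈ Finset.range (Fintype.card G.V), |G.lapEigenvalue k|) (Eventually.of_forall fun x => ?_)
  rw [spectralFunction, Real.norm_eq_abs]
  set k := ⌊((Fintype.card G.V - 1 : ℕ) : ℝ) * x⌋₊
  by_cases hk : k < Fintype.card G.V
  · exact Finset.single_le_sum (f := fun k => |G.lapEigenvalue k|) (fun _ _ => abs_nonneg _)
      (Finset.mem_range.2 hk)
  · rw [lapEigenvalue, dif_neg hk, abs_zero]
    exact Finset.sum_nonneg fun _ _ => abs_nonneg _

/-- The spectral function is an affine reparametrisation of the step function of the decreasing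
eigenvalue sequence. -/
lemma spectralFunction_ae_eq (G : FinGraph) (hG : 2 ≤ Fintype.card G.V) {M : ℝ} (hM : 0 < M) :
    G.spectralFunction =ᵐ[volume.restrict (Set.Icc (0 : ℝ) 1)] fun x =>
      stepFunction M G.graph.lapEig
        (-((Fintype.card G.V - 1) / M) * x + Fintype.card G.V / M) := by
  obtain ⟨N, hN⟩ : ∃ N, Fintype.card G.V = N + 1 := ⟨Fintype.card G.V - 1, by omega⟩
  have hN0 : (0 : ℝ) < N := by exact_mod_cast (by omega : 0 < N)
  -- Reversing the order turns a floor into a ceiling; the two sides may differ by one index where N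
  -- x is an integer, so this countable set is discarded.
  have hc : (Set.range fun k : ℕ => (k : ℝ) / N).Countable := Set.countable_range _
  filter_upwards [hc.ae_notMem _, ae_restrict_mem measurableSet_Icc] with x hx hx01
  have hz0 : 0 ≤ (N : ℝ) * x := mul_nonneg hN0.le hx01.1
  have hzN : (N : ℝ) * x ≤ N := mul_le_of_le_one_right hN0.le hx01.2
  set k := ⌊(N : ℝ) * x⌋₊ with hk
  have hk1 : (k : ℝ) < N * x := by
    refine lt_of_le_of_ne (Nat.floor_le hz0) fun h => hx ⟨k, ?_⟩
    dsimp only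
    rw [h]
    field_simp
  have hk2 : (N : ℝ) * x < k + 1 := Nat.lt_floor_add_one _
  have hkN : k < N := by exact_mod_cast hk1.trans_le hzN
  have hφ : M * (-((((N + 1 : ℕ) : ℝ) - 1) / M) * x + ((N + 1 : ℕ) : ℝ) / M) =
      N - N * x + 1 := by
    push_cast
    field_simp
    ring
  have hφ0 : 0 ≤ -((((N + 1 : ℕ) : ℝ) - 1) / M) * x + ((N + 1 : ℕ) : ℝ) / M := by
    have : 0 < M * (-((((N + 1 : ℕ) : ℝ) - 1) / M) * x + ((N + 1 : ℕ) : ℝ) / M) := by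
      rw [hφ]
      linarith
    exact (pos_of_mul_pos_right this hM.le).le
  have hfloor : ⌊(N : ℝ) - N * x + 1⌋₊ = N - k := by
    rw [Nat.floor_eq_iff (by linarith), Nat.cast_sub hkN.le]
    constructor <;> linarith
  rw [stepFunction, hN, if_pos hφ0, hφ, hfloor, spectralFunction, hN, Nat.add_sub_cancel, ← hk,
    lapEigenvalue_eq_lapEig _ (by omega), hN, Nat.add_sub_cancel]

/-- The decreasing eigenvalue sequence of a refinement of the simplex, as a step function with
`(D!)ᵐ` steps per unit of length. -/
noncomputable def simplexStep (D m : ℕ) : ℝ → ℝ :=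
  stepFunction ((D.factorial : ℝ) ^ m) ((complete D).iter m).graph.lapEig

lemma factorial_pow_pos (D m : ℕ) : (0 : ℝ) < (D.factorial : ℝ) ^ m :=
  pow_pos (by exact_mod_cast D.factorial_pos) m

lemma memLp_simplexStep (D m : ℕ) : MemLp (simplexStep D m) 1 volume :=
  memLp_stepFunction (factorial_pow_pos D m) fun _ h => SimpleGraph.lapEig_of_card_le _ h

lemma eLpNorm_stepFunction_sub_interior (D : ℕ) (G : FinGraph) (m : ℕ) {M : ℝ} (hM : 0 < M) :
    eLpNorm (stepFunction M (G.iter m).graph.lapEig - stepFunction M (interior D G m).lapEig) 1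
      volume = ENNReal.ofReal (removed D G m / M) := by
  classical
  rw [stepFunction_sub, eLpNorm_stepFunction hM (N := Fintype.card (G.iter m).V),
    SimpleGraph.sum_abs_lapEig_sub (interior_le D G m) le_rfl, removed, Nat.card_eq_fintype_card]
  intro j hj
  rw [SimpleGraph.lapEig_of_card_le _ hj, SimpleGraph.lapEig_of_card_le _ hj, sub_zero]

/-- Triangle inequality through the common step function of the two interior graphs. The subdivided
simplex loses at most D! times as many edges, but its steps are D! times finer, so both errors obey
the same bound. -/
lemma eLpNorm_simplexStep_sub_succ_le (D m : ℕ) :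
    eLpNorm (simplexStep D m - simplexStep D (m + 1)) 1 volume ≤
      ENNReal.ofReal (2 * (removed D (complete D) m / (D.factorial : ℝ) ^ m)) := by
  have hD := factorial_pow_pos D m
  have hD' := factorial_pow_pos D (m + 1)
  have hD0 : (0 : ℝ) < D.factorial := by exact_mod_cast D.factorial_pos
  have hstep : stepFunction ((D.factorial : ℝ) ^ (m + 1)) (interior D (complete D).refine m).lapEig =
      stepFunction ((D.factorial : ℝ) ^ m) (interior D (complete D) m).lapEig := by
    have h : (interior D (complete D).refine m).lapEig =
        fun j => (interior D (complete D) m).lapEig (j / D.factorial) :=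
      funext (lapEig_interior_refine D m)
    rw [h, pow_succ', stepFunction_mul_div _ _ D.factorial_ne_zero]
  have h1 := eLpNorm_stepFunction_sub_interior D (complete D) m hD
  have h2 := eLpNorm_stepFunction_sub_interior D (complete D).refine m hD'
  rw [hstep, iter_refine, eLpNorm_sub_comm] at h2
  have h3 : (removed D (complete D).refine m : ℝ) / (D.factorial : ℝ) ^ (m + 1) ≤
      removed D (complete D) m / (D.factorial : ℝ) ^ m := by
    rw [pow_succ', div_le_div_iff₀ (by positivity) hD]
    have : (removed D (complete D).refine m : ℝ) ≤ D.factorial * removed D (complete D) m := by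
      exact_mod_cast removed_refine_le D m
    calc _ ≤ (D.factorial * removed D (complete D) m : ℝ) * (D.factorial : ℝ) ^ m := by gcongr
      _ = _ := by ring
  refine (eLpNorm_one_sub_le_add (measurable_stepFunction _ _).aestronglyMeasurable
    (measurable_stepFunction ((D.factorial : ℝ) ^ m)
      (interior D (complete D) m).lapEig).aestronglyMeasurable
    (measurable_stepFunction _ _).aestronglyMeasurable).trans ?_
  refine (add_le_add h1.le (h2.le.trans (ENNReal.ofReal_le_ofReal h3))).trans ?_
  rw [← ENNReal.ofReal_add (by positivity) (by positivity), two_mul]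

/-- The ratio of the geometric decay is d · d! / (d+1)! = d/(d+1). -/
lemma removed_div_le (d m : ℕ) :
    (removed (d + 1) (complete (d + 1)) (m + 1) : ℝ) / ((d + 1).factorial : ℝ) ^ (m + 1) ≤
      (d + 1) ^ 2 * ((d : ℝ) / (d + 1)) ^ m := by
  have h := (removed_succ_le d m).trans (Nat.mul_le_mul_left _ (boundaryCount_le d m))
  rw [div_le_iff₀ (factorial_pow_pos _ _)]
  calc (removed (d + 1) (complete (d + 1)) (m + 1) : ℝ)
      ≤ (d + 1) ^ 2 * ((d * d.factorial) ^ m * (d + 1).factorial) := by exact_mod_cast h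
    _ = _ := by
      have : ((d : ℝ) * d.factorial) ^ m = (d / (d + 1)) ^ m * ((d + 1).factorial : ℝ) ^ m := by
        rw [← mul_pow, Nat.factorial_succ]
        congr 1
        push_cast
        field_simp
      rw [this]
      ring

lemma exists_tendsto_simplexStep (d : ℕ) :
    ∃ F, MemLp F 1 volume ∧
      Tendsto (fun m => eLpNorm (simplexStep (d + 1) m - F) 1 volume) atTop (𝓝 0) := by
  obtain ⟨F, hF, hlim⟩ := exists_tendsto_eLpNorm_of_le_geometric
    (f := fun m => simplexStep (d + 1) (m + 1)) (fun m => memLp_simplexStep _ _)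
    (C := ENNReal.ofReal (2 * (d + 1) ^ 2)) (r := ENNReal.ofReal ((d : ℝ) / (d + 1)))
    (by
      rw [ENNReal.ofReal_lt_one, div_lt_one (by positivity)]
      linarith)
    ENNReal.ofReal_ne_top
    (fun m => by
      refine (eLpNorm_simplexStep_sub_succ_le (d + 1) (m + 1)).trans ?_
      rw [← ENNReal.ofReal_pow (by positivity), ← ENNReal.ofReal_mul (by positivity)]
      refine ENNReal.ofReal_le_ofReal ?_
      rw [mul_assoc]
      exact mul_le_mul_of_nonneg_left (removed_div_le d m) zero_le_two)
  exact ⟨F, hF, (tendsto_add_atTop_iff_nat 1).1 hlim⟩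

/-- The number of vertices per facet converges to a positive limit. -/
lemma exists_tendsto_card_div {d : ℕ} :
    ∃ c : ℝ, 0 < c ∧ Tendsto (fun m => (Fintype.card ((complete (d + 1)).iter m).V : ℝ) /
      ((d + 1).factorial : ℝ) ^ m) atTop (𝓝 c) := by
  set u : ℕ → ℝ := fun m => (Fintype.card ((complete (d + 1)).iter m).V : ℝ) /
      ((d + 1).factorial : ℝ) ^ m with hu
  have hD0 : (0 : ℝ) < (d + 1).factorial := by exact_mod_cast (d + 1).factorial_pos
  have hanti : Antitone u := by
    refine antitone_nat_of_succ_le fun m => ?_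
    have h := card_iter_succ_le (d + 1) m
    rw [Nat.card_eq_fintype_card, Nat.card_eq_fintype_card] at h
    simp only [hu]
    rw [div_le_div_iff₀ (by positivity) (by positivity), pow_succ']
    calc _ ≤ ((d + 1).factorial * Fintype.card ((complete (d + 1)).iter m).V : ℝ) *
          ((d + 1).factorial : ℝ) ^ m := by
            gcongr
            exact_mod_cast h
      _ = _ := by ring
  have hbdd : BddBelow (Set.range u) := ⟨0, by
    rintro _ ⟨m, rfl⟩
    positivity⟩
  have hlim := tendsto_atTop_ciInf hanti hbdd
  -- The bound (D!)^(m+1) on the vertices at level m + 2 keeps the decreasing sequence above 1/D!.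
  refine ⟨_, lt_of_lt_of_le (inv_pos.2 hD0)
    (ge_of_tendsto ((tendsto_add_atTop_iff_nat 2).2 hlim) (Eventually.of_forall fun m => ?_)), hlim⟩
  have h := pow_le_card_iter d.succ_pos m
  rw [Nat.card_eq_fintype_card] at h
  simp only [hu]
  rw [le_div_iff₀ (by positivity)]
  calc _ = ((d + 1).factorial : ℝ) ^ (m + 1) := by
        rw [pow_succ _ (m + 1)]
        field_simp
    _ ≤ _ := by exact_mod_cast h

end FinGraph

theorem mainTheorem2 (d : ℕ) (hd : 1 ≤ d) :
    (∀ m : ℕ, MemLp ((FinGraph.complete (d + 1)).iterRefine m).spectralFunction 1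
      (volume.restrict (Set.Icc (0 : ℝ) 1))) ∧
    ∃ F : ℝ → ℝ, MemLp F 1 (volume.restrict (Set.Icc (0 : ℝ) 1)) ∧
      Tendsto (fun m : ℕ =>
          eLpNorm (fun x => ((FinGraph.complete (d + 1)).iterRefine m).spectralFunction x - F x) 1
            (volume.restrict (Set.Icc (0 : ℝ) 1)))
        atTop (𝓝 0) := by
  refine ⟨fun m => FinGraph.memLp_spectralFunction _, ?_⟩
  simp only [FinGraph.iterRefine_eq_iter]
  obtain ⟨F, hF, hlim⟩ := FinGraph.exists_tendsto_simplexStep d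
  obtain ⟨c, hc, hcard⟩ := FinGraph.exists_tendsto_card_div (d := d)
  set M : ℕ → ℝ := fun m => ((d + 1).factorial : ℝ) ^ m with hM
  set n : ℕ → ℝ := fun m => (Fintype.card ((FinGraph.complete (d + 1)).iter m).V : ℝ) with hn
  have hM0 : ∀ m, 0 < M m := FinGraph.factorial_pow_pos (d + 1)
  have hMtop : Tendsto M atTop atTop := by
    refine tendsto_pow_atTop_atTop_of_one_lt ?_
    -- This needs d ≥ 1: for d = 0 the refinements would not grow.
    exact_mod_cast Nat.one_lt_factorial.2 (by omega)
  have hα : Tendsto (fun m => -((n m - 1) / M m)) atTop (𝓝 (-c)) := by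
    have := (hcard.sub (tendsto_inv_atTop_zero.comp hMtop)).neg
    rw [sub_zero] at this
    refine this.congr fun m => ?_
    simp only [Function.comp_apply]
    ring
  have hntop : Tendsto n atTop atTop := by
    refine (hcard.pos_mul_atTop hc hMtop).congr fun m => ?_
    exact div_mul_cancel₀ _ (hM0 m).ne'
  -- Increasing order on [0,1] corresponds to running backwards through [0, c], where c is the
  -- limiting number of vertices per facet.
  refine ⟨fun x => F (-c * x + c), (hF.comp_affine (neg_ne_zero.2 hc.ne') c).restrict _, ?_⟩
  have h2 := tendsto_eLpNorm_comp_affine_sub hF (neg_ne_zero.2 hc.ne') hα hcard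
  have h1 : Tendsto (fun m => ENNReal.ofReal |(-((n m - 1) / M m))⁻¹| *
      eLpNorm (FinGraph.simplexStep (d + 1) m - F) 1 volume) atTop (𝓝 0) := by
    have := ENNReal.Tendsto.mul
      (ENNReal.tendsto_ofReal (hα.inv₀ (neg_ne_zero.2 hc.ne')).abs)
      (Or.inr ENNReal.zero_ne_top) hlim (Or.inr ENNReal.ofReal_ne_top)
    rwa [mul_zero] at this
  have h12 := h1.add h2
  rw [add_zero] at h12
  refine tendsto_of_tendsto_of_tendsto_of_le_of_le' tendsto_const_nhds h12
    (Eventually.of_forall fun m => zero_le) ?_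
  filter_upwards [hntop.eventually_ge_atTop 2] with m hm
  have hm2 : 2 ≤ Fintype.card ((FinGraph.complete (d + 1)).iter m).V := by
    simp only [hn] at hm
    exact_mod_cast hm
  have hne : -((n m - 1) / M m) ≠ 0 :=
    neg_ne_zero.2 (div_pos (by linarith) (hM0 m)).ne'
  have hae := FinGraph.spectralFunction_ae_eq _ hm2 (hM0 m)
  refine (eLpNorm_congr_ae (hae.sub (EventuallyEq.refl _ fun x => F (-c * x + c)))).trans_le ?_
  refine (eLpNorm_one_sub_le_add
    ((FinGraph.memLp_simplexStep (d + 1) m).comp_affine hne (n m / M m)).1.restrict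
    (hF.comp_affine hne (n m / M m)).1.restrict
    (hF.comp_affine (neg_ne_zero.2 hc.ne') c).1.restrict).trans ?_
  refine add_le_add ((eLpNorm_mono_measure _ Measure.restrict_le_self).trans ?_) le_rfl
  exact (eLpNorm_comp_affine (FinGraph.simplexStep (d + 1) m - F) hne (n m / M m)).le
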